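/- **Setting.** Fix a horizon $T\in\mathbb N$. A deterministic forecaster $\mathcal A$ maps, for each step $t\in\{1,\dots,T\}$, the past outcomes $(x_1,\dots,x_{t-1})\in\{0,1\}^{t-1}$ to a prediction $p_t\in[0,1]$. For $x\in\{0,1\}^T$ and $p\in[0,1]^T$ let $$\mathsf{smCE}(x,p)=\sup_{f}\sum_{t=1}^T f(p_t)(x_t-p_t),\qquad \mathsf{CalDist}(x,p)=\min_{q\in\mathcal C(x)}\|p-q\|_1,$$ where $f$ ranges over the $1$-Lipschitz functions $[0,1]\to[-1,1]$, and $\mathcal C(x)$ is the set of $q\in[0,1]^T$ with $\sum_{t}(x_t-q_t)\mathbf 1[q_t=a]=0$ for every $a\in[0,1]$. For a distribution $\mathcal D$ on $\{0,1\}^T$ and $\mathsf{CM}\in\{\mathsf{smCE},\mathsf{CalDist}\}$ let $\mathsf{err}_{\mathsf{CM}}(\mathcal D,\mathcal A)=\mathbb E_{x\sim\mathcal D}[\mathsf{CM}(x,p)]$, where $p$ is the sequence of predictions of $\mathcal A$ on $x$. The truthful forecaster $\mathcal A^{\mathrm{truthful}}(\mathcal D)$ predicts $\Pr_{x\sim\mathcal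 D}[x_t=1\mid x_1=b_1,\dots,x_{t-1}=b_{t-1}]$ after the history $b_1,\dots,b_{t-1}$. **Algorithm.** Given $p^\star\in[0,1]^T$, the forecaster $\mathcal A_{p^\star}$ works in rounds. If a round starts after $t<T$ steps, let $L=T-t$ and $H=\lfloor L/2\rfloor$. If $L=1$, predict $0$ and stop. Otherwise put $$\mu_1=\frac1H\sum_{s=t+1}^{t+H}p^\star_s,\qquad \mu_2=\frac1H\sum_{s=t+H+1}^{t+2H}p^\star_s,\qquad \mu=\frac{\mu_1+\mu_2}2,$$ and let $\Delta$ be the running sum of (outcome $-$ prediction) within the round, starting at $0$. 1. If $|\mu_1-\mu|\ge\sqrt{2\ln L/H}$, predict $\alpha=(\mu_1+\mu)/2$ for at most $2H$ steps, ending the round after the first step $i>H$ of the round at whose end $|\Delta|\le1$ (and after $2H$ steps at the latest). 2. Otherwise choose $\alpha$ as follows. If $\mu_1\le\frac12$: $\alpha=\mu_1$ when $\mu_1\ge10\sqrt{\ln L/H}$, and $\alpha=\max\{\mu_1-\sqrt{2\mu_1\ln L/H},0\}$ when not. If $\mu_1>\frac12$: $\alpha=\mu_1$ when $1-\mu_1\ge10\sqrt{\ln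 L/H}$, and $\alpha=\min\{\mu_1+\sqrt{2(1-\mu_1)\ln L/H},1\}$ when not. Predict $\alpha$ for $H$ steps, and let $\Delta_1$ be the value of $\Delta$ then. Let $\beta=\min\{\mu_2+\Delta_1/H+\sqrt{\ln L/(2H)},1\}$ if $\Delta_1\ge0$, and $\beta=\max\{\mu_2+\Delta_1/H-\sqrt{\ln L/(2H)},0\}$ if $\Delta_1<0$. Predict $\beta$ for at most $H$ further steps, ending the round after the first of them at whose end $|\Delta|\le1$ (and after $H$ of them at the latest). When a round ends and fewer than $T$ steps have been made, the next round starts. **Theorem.** (a) There is a universal constant $C>0$ such that for every $T\ge2$ and every $p^\star\in[0,1]^T$, with $\mathcal D=\prod_{t=1}^T\mathrm{Bern}(p^\star_t)$, $$\mathsf{err}_{\mathsf{smCE}}(\mathcal D,\mathcal A_{p^\star})\le C(\ln T)^{3/2}\quad\text{and}\quad \mathsf{err}_{\mathsf{CalDist}}(\mathcal D,\mathcal A_{p^\star})\le C(\ln T)^{3/2}.$$ (b) For every $\delta\in(0,1/2]$ there is a constant $c>0$, depending only on $\delta$, such that for every $T\ge0$ and every $p^\star\in[\delta,1-\delta]^T$,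 with $\mathcal D=\prod_{t=1}^T\mathrm{Bern}(p^\star_t)$, $$\mathsf{err}_{\mathsf{smCE}}(\mathcal D,\mathcal A^{\mathrm{truthful}}(\mathcal D))\ge c\sqrt T\quad\text{and}\quad \mathsf{err}_{\mathsf{CalDist}}(\mathcal D,\mathcal A^{\mathrm{truthful}}(\mathcal D))\ge c\sqrt T.$$ -/

import Mathlib

open MeasureTheory

noncomputable section

namespace SeqPred

/-! ### Sequential prediction of binary outcomes -/

/-- The real value of a binary outcome: `true` is `1` and `false` is `0`. -/
def bit (b : Bool) : ℝ := if b then 1 else 0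

/-- A deterministic forecaster with horizon `T`: for each step `t` (numbered `0, …, T - 1`) it maps
the `t` outcomes that were observed before that step to a prediction in `[0, 1]`. -/
abbrev Forecaster (T : ℕ) : Type := (t : Fin T) → (Fin (t : ℕ) → Bool) → unitInterval

/-- The first `t` entries of an outcome sequence of length `T`. -/
def history {T : ℕ} (x : Fin T → Bool) (t : Fin T) : Fin (t : ℕ) → Bool :=
  fun s => x ⟨s, s.isLt.trans t.isLt⟩

/-- The predictions that a forecaster makes on the outcome sequence `x`. -/
def run {T : ℕ} (A : Forecaster T) (x : Fin T → Bool) : Fin T → unitInterval :=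
  fun t => A t (history x t)

/-- The expected penalty of the forecaster `A` on the distribution `D`, for the calibration
measure `CM`. -/
def err {T : ℕ} (CM : (Fin T → Bool) → (Fin T → unitInterval) → ℝ)
    (D : Measure (Fin T → Bool)) (A : Forecaster T) : ℝ :=
  ∫ x, CM x (run A x) ∂D

/-- The truthful forecaster for `D`: it predicts the conditional probability of `x t = true`
given the observed history. (On histories of probability zero the value is irrelevant; it is `0`.) -/
def truthful {T : ℕ} (D : Measure (Fin T → Bool)) : Forecaster T := fun t b =>
  ⟨(ProbabilityTheory.cond D {x | history x t = b}).real {x | x t = true},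
    measureReal_nonneg, by
      rw [Measure.real]
      exact ENNReal.toReal_le_of_le_ofReal zero_le_one (by simpa using prob_le_one)⟩

/-- The product distribution `∏ Bern(p t)` on `{0, 1}^T`. -/
def productBernoulli {T : ℕ} (p : Fin T → unitInterval) : Measure (Fin T → Bool) :=
  Measure.pi fun t => ProbabilityTheory.bernoulliMeasure true false (p t)

/-! ### Calibration measures -/

/-- The smooth calibration error: the supremum of `∑ f(p t) (x t - p t)` over all `1`-Lipschitz
functions `f` from `[0, 1]` to `[-1, 1]`. -/
def smCE {T : ℕ} (x : Fin T → Bool) (p : Fin T → unitInterval) : ℝ :=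
  sSup {s : ℝ | ∃ f : unitInterval → ℝ, LipschitzWith 1 f ∧ (∀ a, f a ∈ Set.Icc (-1 : ℝ) 1) ∧
    s = ∑ t, f (p t) * (bit (x t) - p t)}

open Classical in
/-- The predictions `q` are perfectly calibrated for the outcomes `x`. -/
def PerfectlyCalibrated {T : ℕ} (x : Fin T → Bool) (q : Fin T → unitInterval) : Prop :=
  ∀ a : unitInterval, ∑ t, (if q t = a then bit (x t) - q t else 0) = 0

/-- The distance from calibration: the least `ℓ¹` distance from `p` to a vector of predictions that
is perfectly calibrated for `x`. -/
def calDist {T : ℕ} (x : Fin T → Bool) (p : Fin T → unitInterval) : ℝ :=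
  sInf {d : ℝ | ∃ q : Fin T → unitInterval, PerfectlyCalibrated x q ∧
    d = ∑ t, |(p t : ℝ) - q t|}

/-! ### The forecasting algorithm for product distributions

The algorithm works in rounds. A round is determined by the number `t` of steps that precede it:
`len = T - t` steps remain, and `half = ⌊len / 2⌋`. -/

/-- The parameters `p 0, …, p (T - 1)`, continued by zeros. -/
def param {T : ℕ} (p : Fin T → unitInterval) (s : ℕ) : ℝ :=
  if h : s < T then (p ⟨s, h⟩ : ℝ) else 0

/-- The number `T^(r)` of remaining steps when a round starts after `t` steps. -/
def len (T t : ℕ) : ℕ := T - t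

/-- `H^(r)`, half of the number of remaining steps, rounded down. -/
def half (T t : ℕ) : ℕ := len T t / 2

/-- The average of the parameters over the next `half` steps. -/
def muFirst {T : ℕ} (p : Fin T → unitInterval) (t : ℕ) : ℝ :=
  (∑ j ∈ Finset.range (half T t), param p (t + j)) / half T t

/-- The average of the parameters over the `half` steps after those. -/
def muSecond {T : ℕ} (p : Fin T → unitInterval) (t : ℕ) : ℝ :=
  (∑ j ∈ Finset.range (half T t), param p (t + half T t + j)) / half T t

/-- The average of the two half averages. -/
def mu {T : ℕ} (p : Fin T → unitInterval) (t : ℕ) : ℝ := (muFirst p t + muSecond p t) / 2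

/-- The condition of the outer if-statement: the two half averages are far apart. -/
def FarApart {T : ℕ} (p : Fin T → unitInterval) (t : ℕ) : Prop :=
  Real.sqrt (2 * Real.log (len T t) / half T t) ≤ |muFirst p t - mu p t|

open Classical in
/-- The value `α^(r)`: the prediction throughout the round if the half averages are far apart, and
the prediction in the first `half` steps of the round otherwise. -/
def alpha {T : ℕ} (p : Fin T → unitInterval) (t : ℕ) : ℝ :=
  if FarApart p t then (muFirst p t + mu p t) / 2
  else if muFirst p t ≤ 1 / 2 then
    if 10 * Real.sqrt (Real.log (len T t) / half T t) ≤ muFirst p t then muFirst p t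
    else max (muFirst p t - Real.sqrt (2 * muFirst p t * Real.log (len T t) / half T t)) 0
  else
    if 10 * Real.sqrt (Real.log (len T t) / half T t) ≤ 1 - muFirst p t then muFirst p t
    else min (muFirst p t + Real.sqrt (2 * (1 - muFirst p t) * Real.log (len T t) / half T t)) 1

/-- The value `β^(r)`, predicted after the first `half` steps of the round if the half averages are
not far apart; `Δ` is the bias of the round after its first `half` steps. -/
def beta {T : ℕ} (p : Fin T → unitInterval) (t : ℕ) (Δ : ℝ) : ℝ :=
  if 0 ≤ Δ then
    min (muSecond p t + Δ / half T t + Real.sqrt (Real.log (len T t) / (2 * half T t))) 1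
  else
    max (muSecond p t + Δ / half T t - Real.sqrt (Real.log (len T t) / (2 * half T t))) 0

/-- The variables of the algorithm between two steps. -/
structure State where
  /-- the number of steps that precede the current round -/
  start : ℕ
  /-- the number of completed steps of the current round -/
  i : ℕ
  /-- the bias `Δ^(r)`: the sum of outcome minus prediction over these `i` steps -/
  bias : ℝ
  /-- the value of the bias at the end of the first `half` steps of the current round
  (meaningful only from then on) -/
  firstBias : ℝ

/-- The state at the beginning of the round that starts after `t` steps. -/
def State.new (t : ℕ) : State := ⟨t, 0, 0, 0⟩

open Classical in
/-- The next prediction in a given state, as a real number. -/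
def predictReal {T : ℕ} (p : Fin T → unitInterval) (st : State) : ℝ :=
  if len T st.start = 1 then 0
  else if FarApart p st.start ∨ st.i < half T st.start then alpha p st.start
  else beta p st.start st.firstBias

lemma param_mem {T : ℕ} (p : Fin T → unitInterval) (s : ℕ) : param p s ∈ Set.Icc (0 : ℝ) 1 := by
  unfold param
  split_ifs with h
  · exact (p ⟨s, h⟩).2
  · simp

lemma average_mem (n : ℕ) (g : ℕ → ℝ) (hg : ∀ j, g j ∈ Set.Icc (0 : ℝ) 1) :
    (∑ j ∈ Finset.range n, g j) / n ∈ Set.Icc (0 : ℝ) 1 := by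
  refine ⟨div_nonneg (Finset.sum_nonneg fun j _ => (hg j).1) n.cast_nonneg, ?_⟩
  refine div_le_one_of_le₀ ?_ n.cast_nonneg
  calc ∑ j ∈ Finset.range n, g j ≤ ∑ _j ∈ Finset.range n, (1 : ℝ) :=
        Finset.sum_le_sum fun j _ => (hg j).2
    _ = n := by simp

lemma muFirst_mem {T : ℕ} (p : Fin T → unitInterval) (t : ℕ) :
    muFirst p t ∈ Set.Icc (0 : ℝ) 1 := average_mem _ _ fun _ => param_mem p _

lemma muSecond_mem {T : ℕ} (p : Fin T → unitInterval) (t : ℕ) :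
    muSecond p t ∈ Set.Icc (0 : ℝ) 1 := average_mem _ _ fun _ => param_mem p _

lemma alpha_mem {T : ℕ} (p : Fin T → unitInterval) (t : ℕ) : alpha p t ∈ Set.Icc (0 : ℝ) 1 := by
  obtain ⟨h0, h1⟩ := muFirst_mem p t
  obtain ⟨k0, k1⟩ := muSecond_mem p t
  unfold alpha
  split_ifs
  · constructor <;> unfold mu <;> linarith
  · exact ⟨h0, h1⟩
  · have hs := Real.sqrt_nonneg (2 * muFirst p t * Real.log (len T t) / half T t)
    exact ⟨le_max_right _ _, max_le (by linarith) zero_le_one⟩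
  · exact ⟨h0, h1⟩
  · exact ⟨le_min (by positivity) zero_le_one, min_le_right _ _⟩

lemma beta_mem {T : ℕ} (p : Fin T → unitInterval) (t : ℕ) (Δ : ℝ) :
    beta p t Δ ∈ Set.Icc (0 : ℝ) 1 := by
  obtain ⟨k0, k1⟩ := muSecond_mem p t
  unfold beta
  split_ifs with h
  · exact ⟨le_min (by positivity) zero_le_one, min_le_right _ _⟩
  · have h1 : Δ / half T t ≤ 0 := div_nonpos_of_nonpos_of_nonneg (by linarith) (by positivity)
    have hs := Real.sqrt_nonneg (Real.log (len T t) / (2 * half T t))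
    exact ⟨le_max_right _ _, max_le (by linarith) zero_le_one⟩

lemma predictReal_mem {T : ℕ} (p : Fin T → unitInterval) (st : State) :
    predictReal p st ∈ Set.Icc (0 : ℝ) 1 := by
  unfold predictReal
  split_ifs
  · simp
  · exact alpha_mem p _
  · exact beta_mem p _ _

/-- The next prediction in a given state. -/
def predict {T : ℕ} (p : Fin T → unitInterval) (st : State) : unitInterval :=
  ⟨predictReal p st, predictReal_mem p st⟩

open Classical in
/-- The state after the outcome `b` of the next step. The round ends as soon as, after more than
`half` of its steps, the bias is at most `1` in absolute value, and at the latest after `2 * half`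
steps. -/
def update {T : ℕ} (p : Fin T → unitInterval) (st : State) (b : Bool) : State :=
  let H := half T st.start
  let i' := st.i + 1
  let bias' := st.bias + (bit b - predict p st)
  if (H < i' ∧ |bias'| ≤ 1) ∨ i' = 2 * H then State.new (st.start + i')
  else ⟨st.start, i', bias', if i' = H then bias' else st.firstBias⟩

/-- The state after the outcomes `b 0, …, b (n - 1)`. -/
def stateAfter {T : ℕ} (p : Fin T → unitInterval) {n : ℕ} (b : Fin n → Bool) : State :=
  (List.ofFn b).foldl (update p) (State.new 0)

/-- The forecasting algorithm for the product distribution with parameters `p`. -/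
def productForecaster {T : ℕ} (p : Fin T → unitInterval) : Forecaster T :=
  fun _ b => predict p (stateAfter p b)

end SeqPred

end

noncomputable section

namespace SeqPred

open ProbabilityTheory

variable {T : ℕ}

/-! ### Deviations of sums of independent Bernoulli outcomes -/

/-! Both parts use that `smCE` is at most twice `calDist` (`smCE_le_two_mul_calDist`): the upper
bound is proved for `calDist`, the lower bound for `smCE`.

Upper bound. A round uses more than half of the remaining steps, so there are at most `Nat.log 2 T +
1` rounds, and distances from calibration on disjoint blocks add up. It remains to see that a round
costs `O(√(log T))` in expectation. Whether a round starts after `t` steps is decided by the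
outcomes before `t`, while `roundCost p t` reads only later ones; hence the expectations factor
(`integral_roundStarts_mul`), and the total is at most the cost per round times the expected number
of rounds.

Write `L` for the number of remaining steps and `H` for half of it. A round with one prediction
costs its final bias. If it has predictions `α`, `β` and bias `Δ` after the first half, one need not
pay `|Δ|`: reassigning `O(|Δ|)` steps of one block to the prediction of the other cancels the two
biases up to their sum, at the price `|α - β|` per step (`calDistLE_two_blocks`, which also treats
predictions near 0 and 1). Since `Δ` has size `√H` and `|α - β|` is `O(√(log L / H) + |Δ| / H)`, the
expected price is `O(√(log L))`.

The final bias is at most 1 unless the round fails, and failure has probability `O(1/L)` when `√(log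
L / H) ≤ 1/40` or the half averages are far apart; in the remaining case `H` is bounded. The bias
moves by at most 1 per step and cannot jump over `[-1, 1]`, so failure means that it keeps its sign
throughout the second half. The predictions are chosen to reverse that sign. If the half averages
are far apart, a value between `μ₁` and `μ` makes the drift over one half and over the whole round
opposite. Otherwise `β` overshoots the value that would cancel `Δ`. The overshoot can be cut off at
0 or 1; near these ends `α` is pushed outwards, so that the bad sign of `Δ` itself requires a large
deviation, whose probability is controlled by a tail bound with the sum of the small parameters as
variance.

Lower bound. The truthful forecaster predicts the parameters themselves, and the constant test
functions `±1` bound `smCE` below by the absolute value of the sum of all noises. Its variance is at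
least of order `δT` and its fourth moment is `O(T²)`, so its first absolute moment is of order `√T`.
-/

instance (p : Fin T → unitInterval) : IsProbabilityMeasure (productBernoulli p) := by
  unfold productBernoulli; infer_instance

/-- The outcome of step `s`, continued by `false` beyond the horizon. -/
def outcome (x : Fin T → Bool) (s : ℕ) : Bool := if h : s < T then x ⟨s, h⟩ else false

/-- The sum of outcome minus parameter over the `n` steps from `a` on. -/
def deviation (p : Fin T → unitInterval) (a n : ℕ) (x : Fin T → Bool) : ℝ :=
  ∑ j ∈ Finset.range n, (bit (outcome x (a + j)) - param p (a + j))

lemma bit_eq (b : Bool) : bit b = 0 ∨ bit b = 1 := by cases b <;> simp [bit]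

lemma bit_nonneg (b : Bool) : 0 ≤ bit b := by cases b <;> simp [bit]

lemma bit_le_one (b : Bool) : bit b ≤ 1 := by cases b <;> simp [bit]

lemma integral_noise (p : Fin T → unitInterval) (s : Fin T) (f : ℝ → ℝ) :
    ∫ x, f (bit (x s) - p s) ∂productBernoulli p
      = (p s : ℝ) * f (1 - p s) + (1 - p s) * f (0 - p s) := by
  have h := (measurePreserving_eval (fun t => bernoulliMeasure true false (p t)) s)
  have := h.hasLaw.integral_comp (X := fun x : Fin T → Bool => x s)
    (f := fun b : Bool => f (bit b - p s)) (Measurable.of_discrete.aestronglyMeasurable)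
  simp only [Function.comp_def] at this
  unfold productBernoulli
  rw [this, integral_bernoulliMeasure]
  simp [bit]

lemma iIndepFun_noise (p : Fin T → unitInterval) :
    iIndepFun (fun s (x : Fin T → Bool) => bit (x s) - p s) (productBernoulli p) :=
  iIndepFun_pi (X := fun s b => bit b - p s) (fun _ => Measurable.of_discrete.aemeasurable)

lemma deviation_eq_sum_fin (p : Fin T → unitInterval) {a n : ℕ} (h : a + n ≤ T) :
    deviation p a n = fun x => ∑ j : Fin n,
      (bit (x ⟨a + j, by omega⟩) - p ⟨a + j, by omega⟩) := by
  funext x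
  rw [deviation, Finset.sum_range]
  refine Finset.sum_congr rfl fun j _ => ?_
  have : a + (j : ℕ) < T := by omega
  simp [outcome, param, this]

lemma iIndepFun_noise_shift (p : Fin T → unitInterval) {a n : ℕ} (h : a + n ≤ T) :
    iIndepFun (fun (j : Fin n) (x : Fin T → Bool) =>
      bit (x ⟨a + j, by omega⟩) - p ⟨a + j, by omega⟩) (productBernoulli p) :=
  (iIndepFun_noise p).precomp (g := fun j : Fin n => (⟨a + j, by omega⟩ : Fin T))
    (fun i j hij => by simpa [Fin.ext_iff] using hij)

/-- Hoeffding's lemma on an interval of length 1: the variance proxy is `(1/2)²`. -/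
lemma hasSubgaussianMGF_noise (p : Fin T → unitInterval) (s : Fin T) :
    HasSubgaussianMGF (fun x : Fin T → Bool => bit (x s) - p s) (1 / 4)
      (productBernoulli p) := by
  have := hasSubgaussianMGF_of_mem_Icc_of_integral_eq_zero
    (X := fun x : Fin T → Bool => bit (x s) - p s) (a := -(p s : ℝ)) (b := 1 - p s)
    (μ := productBernoulli p) Measurable.of_discrete.aemeasurable
    (ae_of_all _ fun x => ⟨by linarith [bit_nonneg (x s)], by linarith [bit_le_one (x s)]⟩)
    (by rw [integral_noise p s (fun y => y)]; ring)
  convert this using 1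
  have : (1 - (p s : ℝ) - -(p s : ℝ)) = 1 := by ring
  rw [this, nnnorm_one]
  norm_num

lemma hasSubgaussianMGF_deviation (p : Fin T → unitInterval) {a n : ℕ} (h : a + n ≤ T) :
    HasSubgaussianMGF (deviation p a n) (n / 4) (productBernoulli p) := by
  rw [deviation_eq_sum_fin p h]
  convert HasSubgaussianMGF.sum_of_iIndepFun (s := Finset.univ) (c := fun _ => 1 / 4)
    (iIndepFun_noise_shift p h) (fun j _ => hasSubgaussianMGF_noise p ⟨a + j, _⟩) using 1
  simp [div_eq_mul_inv]

lemma prob_deviation_ge (p : Fin T → unitInterval) {a n : ℕ} (h : a + n ≤ T) {ε : ℝ}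
    (hε : 0 ≤ ε) :
    (productBernoulli p).real {x | ε ≤ deviation p a n x} ≤ Real.exp (-(2 * ε ^ 2 / n)) := by
  convert (hasSubgaussianMGF_deviation p h).measure_ge_le hε using 2
  push_cast
  rcases Nat.eq_zero_or_pos n with rfl | hn
  · simp
  · field_simp
    ring

lemma prob_deviation_le_neg (p : Fin T → unitInterval) {a n : ℕ} (h : a + n ≤ T) {ε : ℝ}
    (hε : 0 ≤ ε) :
    (productBernoulli p).real {x | deviation p a n x ≤ -ε} ≤ Real.exp (-(2 * ε ^ 2 / n)) := by
  convert (hasSubgaussianMGF_deviation p h).neg.measure_ge_le hε using 2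
  · ext x
    simp [le_neg]
  push_cast
  rcases Nat.eq_zero_or_pos n with rfl | hn
  · simp
  · field_simp
    ring

/-- Even moments of deviations: `E (∑ noise) ^ (2 k) ≤ 4 (2 k)! n ^ k`. -/
lemma integral_deviation_pow_le (p : Fin T → unitInterval) {a n : ℕ} (h : a + n ≤ T) (k : ℕ) :
    ∫ x, deviation p a n x ^ (2 * k) ∂productBernoulli p ≤ 4 * (2 * k).factorial * n ^ k := by
  rcases Nat.eq_zero_or_pos n with rfl | hn
  · rcases Nat.eq_zero_or_pos k with rfl | hk
    · simp
    · simp [deviation, hk.ne']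
  have hn0 : (0 : ℝ) < n := by exact_mod_cast hn
  have hsub := hasSubgaussianMGF_deviation p h
  -- At this scale the moment generating functions at `±l` are at most `exp (1/8)`, and one Taylor
  -- term of the exponential dominates the even power.
  set l : ℝ := 1 / Real.sqrt n with hl
  have hl2 : l ^ 2 = 1 / n := by rw [hl, div_pow, Real.sq_sqrt hn0.le]; simp
  have hpt : ∀ y : ℝ, y ^ (2 * k) ≤ (2 * k).factorial * n ^ k *
      (Real.exp (l * y) + Real.exp (-l * y)) := by
    intro y
    have h1 := Real.pow_div_factorial_le_exp |l * y| (abs_nonneg _) (2 * k)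
    have h2 : |l * y| ^ (2 * k) = (1 / n) ^ k * y ^ (2 * k) := by
      rw [pow_mul, sq_abs, mul_pow, hl2, mul_pow, ← pow_mul]
    have h3 : Real.exp |l * y| ≤ Real.exp (l * y) + Real.exp (-l * y) := by
      rcases abs_cases (l * y) with ⟨h, _⟩ | ⟨h, _⟩ <;> rw [h]
      · linarith [Real.exp_pos (-l * y)]
      · rw [neg_mul]; linarith [Real.exp_pos (l * y)]
    rw [h2, div_le_iff₀ (by positivity)] at h1
    have h4 : y ^ (2 * k) = n ^ k * ((1 / n) ^ k * y ^ (2 * k)) := by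
      rw [← mul_assoc, ← mul_pow, mul_one_div_cancel hn0.ne', one_pow, one_mul]
    rw [h4]
    calc (n : ℝ) ^ k * ((1 / n) ^ k * y ^ (2 * k))
        ≤ n ^ k * (Real.exp |l * y| * (2 * k).factorial) := by gcongr
      _ ≤ n ^ k * ((Real.exp (l * y) + Real.exp (-l * y)) * (2 * k).factorial) := by gcongr
      _ = _ := by ring
  have hm : ∀ t : ℝ, t ^ 2 = 1 / n → mgf (deviation p a n) (productBernoulli p) t ≤ 2 := by
    intro t ht
    refine (hsub.mgf_le t).trans ?_
    rw [ht]
    push_cast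
    have : (n : ℝ) / 4 * (1 / n) / 2 = 1 / 8 := by field_simp; norm_num
    rw [this]
    have := Real.exp_bound_div_one_sub_of_interval (x := 1 / 8) (by norm_num) (by norm_num)
    linarith [show (1 : ℝ) / (1 - 1 / 8) ≤ 2 by norm_num]
  calc ∫ x, deviation p a n x ^ (2 * k) ∂productBernoulli p
      ≤ ∫ x, (2 * k).factorial * n ^ k * (Real.exp (l * deviation p a n x) +
          Real.exp (-l * deviation p a n x)) ∂productBernoulli p :=
        integral_mono .of_finite .of_finite fun x => hpt _
    _ = (2 * k).factorial * n ^ k * (mgf (deviation p a n) (productBernoulli p) l +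
          mgf (deviation p a n) (productBernoulli p) (-l)) := by
        rw [integral_const_mul, integral_add .of_finite .of_finite]; rfl
    _ ≤ (2 * k).factorial * n ^ k * (2 + 2) := by
        gcongr
        · exact hm l hl2
        · exact hm (-l) (by rw [neg_sq, hl2])
    _ = _ := by ring

/-! ### One-sided tails governed by the sum of the parameters -/

lemma exp_neg_le_quadratic {t : ℝ} (ht : 0 ≤ t) : Real.exp (-t) ≤ 1 - t + t ^ 2 / 2 := by
  have h := Real.quadratic_le_exp_of_nonneg ht
  rw [Real.exp_neg, inv_le_iff_one_le_mul₀ (Real.exp_pos t)]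
  have h1 : 0 ≤ 1 - t + t ^ 2 / 2 := by nlinarith [sq_nonneg (t - 1)]
  -- `(1 + t + t²/2)(1 - t + t²/2) = 1 + t⁴/4`.
  nlinarith [mul_le_mul_of_nonneg_left h h1, sq_nonneg (t ^ 2)]

/-- For downward deviations `exp (-t)` lies below its quadratic Taylor polynomial, so `q` serves as
variance proxy with no restriction on the size of `t`. For small `q` this beats Hoeffding's `1/4`.
-/
lemma bernoulli_mgf_le {q t : ℝ} (hq0 : 0 ≤ q) (ht : 0 ≤ t) :
    q * Real.exp (-(t * (1 - q))) + (1 - q) * Real.exp (t * q) ≤ Real.exp (q * t ^ 2 / 2) := by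
  have h1 : q * Real.exp (-(t * (1 - q))) + (1 - q) * Real.exp (t * q)
      = Real.exp (t * q) * (q * (Real.exp (-t) - 1) + 1) := by
    have : Real.exp (-(t * (1 - q))) = Real.exp (t * q) * Real.exp (-t) := by
      rw [← Real.exp_add]; ring_nf
    rw [this]; ring
  rw [h1]
  calc Real.exp (t * q) * (q * (Real.exp (-t) - 1) + 1)
      ≤ Real.exp (t * q) * Real.exp (q * (Real.exp (-t) - 1)) := by
        gcongr; exact Real.add_one_le_exp _
    _ = Real.exp (t * q + q * (Real.exp (-t) - 1)) := by rw [Real.exp_add]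
    _ ≤ _ := by
        apply Real.exp_le_exp.2
        nlinarith [mul_le_mul_of_nonneg_left (exp_neg_le_quadratic ht) hq0]

lemma mgf_deviation (p : Fin T → unitInterval) {a n : ℕ} (h : a + n ≤ T) (t : ℝ) :
    mgf (deviation p a n) (productBernoulli p) t = ∏ j ∈ Finset.range n,
      (param p (a + j) * Real.exp (t * (1 - param p (a + j))) +
        (1 - param p (a + j)) * Real.exp (t * (0 - param p (a + j)))) := by
  rw [deviation_eq_sum_fin p h, Finset.prod_range]
  have := (iIndepFun_noise_shift p h).mgf_sum (t := t) (fun _ => Measurable.of_discrete)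
    Finset.univ
  convert this using 1
  · congr 1
    ext x
    simp
  refine Finset.prod_congr rfl fun j _ => ?_
  rw [mgf, integral_noise p ⟨a + j, by omega⟩ (fun y => Real.exp (t * y))]
  have : a + (j : ℕ) < T := by omega
  simp [param, this]

/-- An upward deviation is a downward deviation of the flipped outcomes, whose parameters add up to
`v`. -/
lemma prob_deviation_ge_of_params (p : Fin T → unitInterval) {a n : ℕ} (h : a + n ≤ T)
    {ε v : ℝ} (hε : 0 ≤ ε) (hv : 0 < v)
    (hvn : ∑ j ∈ Finset.range n, (1 - param p (a + j)) = v) :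
    (productBernoulli p).real {x | ε ≤ deviation p a n x} ≤ Real.exp (-(ε ^ 2 / (2 * v))) := by
  -- The minimizer of `-t ε + v t² / 2`.
  set t := ε / v with ht
  have ht0 : 0 ≤ t := div_nonneg hε hv.le
  refine (measure_ge_le_exp_mul_mgf ε ht0 .of_finite).trans ?_
  have : mgf (deviation p a n) (productBernoulli p) t ≤ Real.exp (v * t ^ 2 / 2) := by
    rw [mgf_deviation p h]
    have h2 : v * t ^ 2 / 2 = ∑ j ∈ Finset.range n, (1 - param p (a + j)) * t ^ 2 / 2 := by
      rw [← hvn, Finset.sum_mul, Finset.sum_div]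
    rw [h2, Real.exp_sum]
    refine Finset.prod_le_prod (fun j _ => ?_) (fun j _ => ?_)
    · have := param_mem p (a + j)
      have h3 : 0 ≤ 1 - param p (a + j) := by linarith [this.2]
      have h4 := this.1
      positivity
    · refine le_of_eq_of_le ?_ (bernoulli_mgf_le (q := 1 - param p (a + j))
        (by linarith [(param_mem p (a + j)).2]) ht0)
      ring_nf
  calc Real.exp (-t * ε) * mgf (deviation p a n) (productBernoulli p) t
      ≤ Real.exp (-t * ε) * Real.exp (v * t ^ 2 / 2) := by gcongr
    _ = _ := by
        rw [← Real.exp_add, ht]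
        congr 1
        field_simp
        ring

lemma prob_deviation_le_neg_of_params (p : Fin T → unitInterval) {a n : ℕ} (h : a + n ≤ T)
    {ε v : ℝ} (hε : 0 ≤ ε) (hv : 0 < v) (hvn : ∑ j ∈ Finset.range n, param p (a + j) = v) :
    (productBernoulli p).real {x | deviation p a n x ≤ -ε} ≤ Real.exp (-(ε ^ 2 / (2 * v))) := by
  set t := -(ε / v) with ht
  have ht0 : t ≤ 0 := neg_nonpos.2 (div_nonneg hε hv.le)
  refine (measure_le_le_exp_mul_mgf (-ε) ht0 .of_finite).trans ?_
  have : mgf (deviation p a n) (productBernoulli p) t ≤ Real.exp (v * t ^ 2 / 2) := by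
    rw [mgf_deviation p h]
    have h2 : v * t ^ 2 / 2 = ∑ j ∈ Finset.range n, param p (a + j) * t ^ 2 / 2 := by
      rw [← hvn, Finset.sum_mul, Finset.sum_div]
    rw [h2, Real.exp_sum]
    refine Finset.prod_le_prod (fun j _ => ?_) (fun j _ => ?_)
    · have := param_mem p (a + j)
      have h3 : 0 ≤ 1 - param p (a + j) := by linarith [this.2]
      have h4 := this.1
      positivity
    · have := bernoulli_mgf_le (q := param p (a + j)) (param_mem p (a + j)).1 (neg_nonneg.2 ht0)
      rw [neg_sq] at this
      refine le_of_eq_of_le ?_ this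
      ring_nf
  calc Real.exp (-t * -ε) * mgf (deviation p a n) (productBernoulli p) t
      ≤ Real.exp (-t * -ε) * Real.exp (v * t ^ 2 / 2) := by gcongr
    _ = _ := by
        rw [← Real.exp_add, ht]
        congr 1
        field_simp
        ring

section Blocks

/-! ### Distance from calibration on blocks of steps -/

open Classical in
/-- On the steps in `S`, the real predictions `π` are within `ℓ¹` distance `d` of predictions in
`[0, 1]` that are perfectly calibrated for the outcomes `X` of these steps. -/
def CalDistLE (S : Finset ℕ) (X π : ℕ → ℝ) (d : ℝ) : Prop :=
  ∃ q : ℕ → ℝ, (∀ s, q s ∈ Set.Icc (0 : ℝ) 1) ∧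
    (∀ a, ∑ s ∈ S, (if q s = a then X s - q s else 0) = 0) ∧ ∑ s ∈ S, |π s - q s| ≤ d

variable {S S' A B M : Finset ℕ} {X π : ℕ → ℝ} {d d' α β : ℝ}

lemma CalDistLE.mono (h : CalDistLE S X π d) (hd : d ≤ d') : CalDistLE S X π d' := by
  obtain ⟨q, h1, h2, h3⟩ := h
  exact ⟨q, h1, h2, h3.trans hd⟩

lemma CalDistLE.empty : CalDistLE ∅ X π 0 := ⟨fun _ => 0, by simp, by simp, by simp⟩

/-- The calibration condition is, for each predicted value, the vanishing of a sum; it is additive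
over disjoint sets even if both sides use the same value. -/
lemma CalDistLE.union (h : CalDistLE S X π d) (h' : CalDistLE S' X π d') (hS : Disjoint S S') :
    CalDistLE (S ∪ S') X π (d + d') := by
  classical
  obtain ⟨q, h1, h2, h3⟩ := h
  obtain ⟨q', h1', h2', h3'⟩ := h'
  have e1 : ∀ s ∈ S, (if s ∈ S then q s else q' s) = q s := fun s hs => if_pos hs
  have e2 : ∀ s ∈ S', (if s ∈ S then q s else q' s) = q' s := fun s hs =>
    if_neg fun h => Finset.disjoint_left.1 hS h hs
  refine ⟨fun s => if s ∈ S then q s else q' s, fun s => ?_, fun a => ?_, ?_⟩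
  · dsimp only; split_ifs
    exacts [h1 s, h1' s]
  · rw [Finset.sum_union hS]
    have k1 := Finset.sum_congr rfl (fun s hs => by rw [e1 s hs] :
      ∀ s ∈ S, (if (if s ∈ S then q s else q' s) = a then X s - (if s ∈ S then q s else q' s)
        else 0) = if q s = a then X s - q s else 0)
    have k2 := Finset.sum_congr rfl (fun s hs => by rw [e2 s hs] :
      ∀ s ∈ S', (if (if s ∈ S then q s else q' s) = a then X s - (if s ∈ S then q s else q' s)
        else 0) = if q' s = a then X s - q' s else 0)
    rw [k1, k2, h2, h2', add_zero]
  · rw [Finset.sum_union hS]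
    refine add_le_add (le_of_eq_of_le (Finset.sum_congr rfl fun s hs => ?_) h3)
      (le_of_eq_of_le (Finset.sum_congr rfl fun s hs => ?_) h3')
    · dsimp only; rw [e1 s hs]
    · dsimp only; rw [e2 s hs]

/-- Predicting the average outcome throughout a block. -/
lemma calDistLE_const (hX : ∀ s, X s = 0 ∨ X s = 1) (γ : ℝ) :
    CalDistLE S X π (∑ s ∈ S, |π s - γ| + |∑ s ∈ S, (X s - γ)|) := by
  rcases S.eq_empty_or_nonempty with rfl | hS
  · simpa using CalDistLE.empty
  have hc : (0 : ℝ) < S.card := by exact_mod_cast hS.card_pos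
  set a := (∑ s ∈ S, X s) / S.card with ha
  have hsum : ∑ s ∈ S, X s = S.card * a := by rw [ha]; field_simp
  have hX0 : ∀ s, 0 ≤ X s := fun s => by rcases hX s with h | h <;> simp [h]
  have hX1 : ∀ s, X s ≤ 1 := fun s => by rcases hX s with h | h <;> simp [h]
  refine ⟨fun _ => a, fun _ => ⟨div_nonneg (Finset.sum_nonneg fun s _ => hX0 s) hc.le, ?_⟩,
    fun b => ?_, ?_⟩
  · rw [ha, div_le_one hc]
    simpa using Finset.sum_le_sum fun s (_ : s ∈ S) => hX1 s
  · dsimp only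
    split_ifs
    · rw [Finset.sum_sub_distrib, hsum]; simp
    · simp
  · have h1 : |∑ s ∈ S, (X s - γ)| = S.card * |γ - a| := by
      rw [Finset.sum_sub_distrib, hsum, Finset.sum_const, nsmul_eq_mul, ← mul_sub, abs_mul,
        abs_of_pos hc, abs_sub_comm]
    rw [h1]
    calc ∑ s ∈ S, |π s - a| ≤ ∑ s ∈ S, (|π s - γ| + |γ - a|) :=
          Finset.sum_le_sum fun s _ => abs_sub_le _ _ _
      _ = _ := by rw [Finset.sum_add_distrib, Finset.sum_const, nsmul_eq_mul]

/-- Two blocks, with constant predictions `α` and `β`, after the steps in `M` were moved from the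
first block to the second one. -/
lemma calDistLE_move (hX : ∀ s, X s = 0 ∨ X s = 1) (hAB : Disjoint A B) (hM : M ⊆ A)
    (hA : ∀ s ∈ A, π s = α) (hB : ∀ s ∈ B, π s = β) :
    CalDistLE (A ∪ B) X π (2 * |∑ s ∈ A, (X s - α) - ∑ s ∈ M, (X s - α)| +
      |∑ s ∈ A, (X s - α) + ∑ s ∈ B, (X s - β)| + 2 * (M.card * |α - β|)) := by
  have hMB : Disjoint M B := hAB.mono_left hM
  have hdisj : Disjoint (A \ M) (M ∪ B) :=
    Finset.disjoint_union_right.2 ⟨Finset.sdiff_disjoint, hAB.mono_left Finset.sdiff_subset⟩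
  have hun : A ∪ B = (A \ M) ∪ (M ∪ B) := by
    rw [← Finset.union_assoc, Finset.sdiff_union_of_subset hM]
  have h1 := calDistLE_const (S := A \ M) (π := π) hX α
  have h2 := calDistLE_const (S := M ∪ B) (π := π) hX β
  rw [hun]
  refine (h1.union h2 hdisj).mono ?_
  have e1 : ∑ s ∈ A \ M, |π s - α| = 0 :=
    Finset.sum_eq_zero fun s hs => by rw [hA s (Finset.sdiff_subset hs)]; simp
  have e2 : ∑ s ∈ M ∪ B, |π s - β| = M.card * |α - β| := by
    rw [Finset.sum_union hMB, Finset.sum_eq_zero (s := B) fun s hs => by rw [hB s hs]; simp,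
      Finset.sum_congr rfl (fun s hs => by rw [hA s (hM hs)] :
        ∀ s ∈ M, |π s - β| = |α - β|)]
    simp
  have e3 : ∑ s ∈ A \ M, (X s - α) = ∑ s ∈ A, (X s - α) - ∑ s ∈ M, (X s - α) := by
    rw [← Finset.sum_sdiff hM]; ring
  -- What the first block loses is gained by the second one, up to the change of prediction on `M`.
  have e4 : ∑ s ∈ M ∪ B, (X s - β) = -(∑ s ∈ A, (X s - α) - ∑ s ∈ M, (X s - α)) +
      (∑ s ∈ A, (X s - α) + ∑ s ∈ B, (X s - β)) + M.card * (α - β) := by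
    rw [Finset.sum_union hMB]
    simp only [Finset.sum_sub_distrib, Finset.sum_const, nsmul_eq_mul]
    ring
  rw [e1, e2, e3, e4]
  have h5 := abs_add_three (-(∑ s ∈ A, (X s - α) - ∑ s ∈ M, (X s - α)))
    (∑ s ∈ A, (X s - α) + ∑ s ∈ B, (X s - β)) (M.card * (α - β))
  rw [abs_neg, abs_mul, Nat.abs_cast] at h5
  linarith

/-- A block with nonnegative bias contains ones that make up for the bias up to rounding. -/
lemma exists_subset_of_bias_nonneg (hX : ∀ s, X s = 0 ∨ X s = 1) (hα0 : 0 ≤ α) (hα1 : α ≤ 1)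
    (hΔ : 0 ≤ ∑ s ∈ A, (X s - α)) :
    ∃ M ⊆ A, |∑ s ∈ A, (X s - α) - ∑ s ∈ M, (X s - α)| ≤ 1 ∧
      M.card * (1 - α) ≤ ∑ s ∈ A, (X s - α) := by
  classical
  set Δ := ∑ s ∈ A, (X s - α) with hdef
  rcases hα1.lt_or_eq with hlt | rfl
  · have hpos : 0 < 1 - α := by linarith
    -- Zeros contribute at most 0, so the ones carry the whole bias. Each contributes `1 - α ≤ 1`,
    -- and `⌊Δ / (1 - α)⌋` of them exhaust it up to 1.
    set O := A.filter (fun s => X s = 1) with hO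
    have hΔO : Δ ≤ O.card * (1 - α) := by
      rw [hdef, ← Finset.sum_filter_add_sum_filter_not A (fun s => X s = 1)]
      have h1 : ∑ s ∈ A with X s = 1, (X s - α) = O.card * (1 - α) := by
        rw [Finset.sum_congr rfl (fun s hs => by rw [(Finset.mem_filter.1 hs).2] :
          ∀ s ∈ A.filter (fun s => X s = 1), X s - α = 1 - α)]
        rw [Finset.sum_const, nsmul_eq_mul]
      have h2 : ∑ s ∈ A with ¬ X s = 1, (X s - α) ≤ 0 := by
        refine Finset.sum_nonpos fun s hs => ?_
        rcases hX s with h | h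
        · rw [h]; linarith
        · exact absurd h (Finset.mem_filter.1 hs).2
      linarith
    have hk : ⌊Δ / (1 - α)⌋₊ ≤ O.card := by
      apply Nat.floor_le_of_le
      rw [div_le_iff₀ hpos]
      exact hΔO
    obtain ⟨M, hM, hcard⟩ := Finset.exists_subset_card_eq hk
    have hsum : ∑ s ∈ M, (X s - α) = M.card * (1 - α) := by
      rw [Finset.sum_congr rfl (fun s hs => by rw [(Finset.mem_filter.1 (hM hs)).2] :
          ∀ s ∈ M, X s - α = 1 - α), Finset.sum_const, nsmul_eq_mul]
    have hf1 := Nat.floor_le (div_nonneg hΔ hpos.le)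
    have hf2 := Nat.lt_floor_add_one (Δ / (1 - α))
    rw [le_div_iff₀ hpos] at hf1
    rw [div_lt_iff₀ hpos] at hf2
    rw [← hcard] at hf1 hf2
    refine ⟨M, hM.trans (Finset.filter_subset _ _), ?_, hf1⟩
    rw [hsum, abs_le]
    constructor <;> nlinarith
  · have : Δ ≤ 0 := Finset.sum_nonpos fun s _ => by rcases hX s with h | h <;> simp [h]
    have h0 : Δ = 0 := le_antisymm this hΔ
    exact ⟨∅, Finset.empty_subset _, by simp [h0], by simp [h0]⟩

lemma exists_subset_of_bias_nonpos (hX : ∀ s, X s = 0 ∨ X s = 1) (hα0 : 0 ≤ α) (hα1 : α ≤ 1)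
    (hΔ : ∑ s ∈ A, (X s - α) ≤ 0) :
    ∃ M ⊆ A, |∑ s ∈ A, (X s - α) - ∑ s ∈ M, (X s - α)| ≤ 1 ∧
      M.card * α ≤ -∑ s ∈ A, (X s - α) := by
  have e : ∀ M : Finset ℕ, ∑ s ∈ M, (1 - X s - (1 - α)) = -∑ s ∈ M, (X s - α) := fun M => by
    rw [← Finset.sum_neg_distrib]; exact Finset.sum_congr rfl fun s _ => by ring
  obtain ⟨M, hM, h1, h2⟩ := exists_subset_of_bias_nonneg (A := A) (X := fun s => 1 - X s)
    (α := 1 - α) (fun s => by rcases hX s with h | h <;> simp [h]) (by linarith) (by linarith)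
    (by rw [e]; linarith)
  rw [e, e] at h1
  rw [e] at h2
  refine ⟨M, hM, ?_, by linarith⟩
  rwa [← abs_neg, neg_sub, sub_neg_eq_add, add_comm, ← sub_eq_add_neg, abs_sub_comm,
    abs_sub_comm] at h1

/-- The number of moved steps has to be `O(|Δ₁|)` up to the total bias. Moving `Δ₁ / (1 - α)` ones
from `A` achieves this unless `α` is near 1. Then zeros of `B` are moved to `A` instead, about `-Δ₂
/ β` of them, unless `β` is near 0. In that last case `|α - β| ≥ 1/2`, and leaving all steps where
they are is affordable. -/
lemma calDistLE_two_blocks_of_nonneg (hX : ∀ s, X s = 0 ∨ X s = 1) (hAB : Disjoint A B)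
    (hα0 : 0 ≤ α) (hα1 : α ≤ 1) (hβ0 : 0 ≤ β) (hβ1 : β ≤ 1)
    (hA : ∀ s ∈ A, π s = α) (hB : ∀ s ∈ B, π s = β) (hΔ : 0 ≤ ∑ s ∈ A, (X s - α)) :
    CalDistLE (A ∪ B) X π (2 + 9 * |∑ s ∈ A, (X s - α) + ∑ s ∈ B, (X s - β)| +
      8 * (|∑ s ∈ A, (X s - α)| * |α - β|)) := by
  have hab : |α - β| ≤ 1 := abs_le.2 ⟨by linarith, by linarith⟩
  have htriv := calDistLE_move hX hAB (Finset.empty_subset A) hA hB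
  simp only [Finset.sum_empty, sub_zero, Finset.card_empty, Nat.cast_zero, zero_mul, mul_zero,
    add_zero] at htriv
  set Δ₁ := ∑ s ∈ A, (X s - α) with h1
  set Δ₂ := ∑ s ∈ B, (X s - β) with h2
  have hd0 := abs_nonneg (α - β)
  have hs0 := abs_nonneg (Δ₁ + Δ₂)
  have hp : 0 ≤ |Δ₁| * |α - β| := by positivity
  rcases le_or_gt α (3 / 4) with ha | ha
  · obtain ⟨M, hM, hM1, hM2⟩ := exists_subset_of_bias_nonneg hX hα0 hα1 hΔ
    refine (calDistLE_move hX hAB hM hA hB).mono ?_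
    rw [← h1] at hM1 hM2 ⊢
    rw [← h2]
    have h3 : (M.card : ℝ) ≤ 4 * |Δ₁| := by
      rw [abs_of_nonneg hΔ]
      nlinarith [(Nat.cast_nonneg M.card : (0 : ℝ) ≤ M.card)]
    have h4 := mul_le_mul_of_nonneg_right h3 hd0
    linarith
  rcases le_or_gt (1 / 4) β with hb | hb
  · rcases le_or_gt Δ₂ 0 with h0 | h0
    · obtain ⟨M, hM, hM1, hM2⟩ := exists_subset_of_bias_nonpos hX hβ0 hβ1 h0
      rw [Finset.union_comm]
      refine (calDistLE_move hX hAB.symm hM hB hA).mono ?_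
      rw [← h2] at hM1 hM2 ⊢
      rw [← h1, add_comm Δ₂, abs_sub_comm β]
      have h3 : (M.card : ℝ) ≤ 4 * (|Δ₁| + |Δ₁ + Δ₂|) := by
        have : -Δ₂ ≤ |Δ₁| + |Δ₁ + Δ₂| := by
          linarith [le_abs_self Δ₁, neg_abs_le (Δ₁ + Δ₂)]
        nlinarith [(Nat.cast_nonneg M.card : (0 : ℝ) ≤ M.card)]
      have h4 := mul_le_mul_of_nonneg_right h3 hd0
      have h5 := mul_le_mul_of_nonneg_left hab hs0
      nlinarith
    · refine htriv.mono ?_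
      rw [abs_of_nonneg hΔ, abs_of_pos (by linarith : 0 < Δ₁ + Δ₂)]
      rw [abs_of_nonneg hΔ] at hp
      linarith
  · refine htriv.mono ?_
    have : 1 / 2 ≤ |α - β| := by rw [abs_of_nonneg] <;> linarith
    nlinarith [abs_nonneg Δ₁]

/-- Exchanging zeros and ones turns a negative bias into a positive one and keeps all distances. -/
lemma calDistLE_two_blocks (hX : ∀ s, X s = 0 ∨ X s = 1) (hAB : Disjoint A B)
    (hα0 : 0 ≤ α) (hα1 : α ≤ 1) (hβ0 : 0 ≤ β) (hβ1 : β ≤ 1)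
    (hA : ∀ s ∈ A, π s = α) (hB : ∀ s ∈ B, π s = β) :
    CalDistLE (A ∪ B) X π (2 + 9 * |∑ s ∈ A, (X s - α) + ∑ s ∈ B, (X s - β)| +
      8 * (|∑ s ∈ A, (X s - α)| * |α - β|)) := by
  rcases le_total 0 (∑ s ∈ A, (X s - α)) with h | h
  · exact calDistLE_two_blocks_of_nonneg hX hAB hα0 hα1 hβ0 hβ1 hA hB h
  have e : ∀ (M : Finset ℕ) (γ : ℝ), ∑ s ∈ M, (1 - X s - (1 - γ)) = -∑ s ∈ M, (X s - γ) :=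
    fun M γ => by
      rw [← Finset.sum_neg_distrib]; exact Finset.sum_congr rfl fun s _ => by ring
  have := calDistLE_two_blocks_of_nonneg (A := A) (B := B) (X := fun s => 1 - X s)
    (π := fun s => 1 - π s) (α := 1 - α) (β := 1 - β)
    (fun s => by rcases hX s with h | h <;> simp [h]) hAB (by linarith) (by linarith)
    (by linarith) (by linarith) (fun s hs => by rw [hA s hs]) (fun s hs => by rw [hB s hs])
    (by rw [e]; linarith)
  rw [e, e, ← neg_add, abs_neg, abs_neg, sub_sub_sub_cancel_left, abs_sub_comm β] at this
  obtain ⟨q, q1, q2, q3⟩ := this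
  refine ⟨fun s => 1 - q s, fun s => ⟨by linarith [(q1 s).2], by linarith [(q1 s).1]⟩,
    fun a => ?_, ?_⟩
  · have hq2 := q2 (1 - a)
    rw [← neg_eq_zero, ← Finset.sum_neg_distrib] at hq2
    refine Eq.trans (Finset.sum_congr rfl fun s _ => ?_) hq2
    dsimp only
    by_cases hq : q s = 1 - a
    · rw [if_pos hq, if_pos (by linarith)]; ring
    · rw [if_neg hq, if_neg (fun h => hq (by linarith))]; simp
  · refine le_of_eq_of_le (Finset.sum_congr rfl fun s _ => ?_) q3
    dsimp only
    rw [abs_sub_comm]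
    congr 1
    ring

end Blocks

/-! ### Calibration measures -/

lemma calDist_le_of_calDistLE {x : Fin T → Bool} {p : Fin T → unitInterval} {π : ℕ → ℝ} {d : ℝ}
    (hπ : ∀ t : Fin T, π t = p t)
    (h : CalDistLE (Finset.range T) (fun s => bit (outcome x s)) π d) : calDist x p ≤ d := by
  classical
  obtain ⟨q, h1, h2, h3⟩ := h
  refine le_trans (csInf_le ⟨0, ?_⟩ ⟨fun t => ⟨q t, h1 t⟩, fun a => ?_, rfl⟩) (le_trans ?_ h3)
  · rintro _ ⟨q, _, rfl⟩
    exact Finset.sum_nonneg fun _ _ => abs_nonneg _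
  · have h2a := h2 a
    rw [Finset.sum_range] at h2a
    refine Eq.trans (Finset.sum_congr rfl fun t _ => ?_) h2a
    simp [outcome, Subtype.ext_iff]
  · rw [Finset.sum_range]
    exact Finset.sum_le_sum fun t _ => by rw [hπ]

/-- Group the steps by their predicted value: `f` is constant on each group. -/
lemma sum_mul_sub_eq_zero_of_perfectlyCalibrated {x : Fin T → Bool} {q : Fin T → unitInterval}
    (h : PerfectlyCalibrated x q) (f : unitInterval → ℝ) :
    ∑ t, f (q t) * (bit (x t) - q t) = 0 := by
  classical
  have h1 : ∀ t, f (q t) * (bit (x t) - q t) = ∑ a ∈ Finset.univ.image q,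
      (if q t = a then f a * (bit (x t) - q t) else 0) := fun t => by
    rw [Finset.sum_ite_eq, if_pos (Finset.mem_image_of_mem q (Finset.mem_univ t))]
  rw [Finset.sum_congr rfl fun t _ => h1 t, Finset.sum_comm]
  refine Finset.sum_eq_zero fun a _ => ?_
  have ha := congrArg (f a * ·) (h a)
  simp only [Finset.mul_sum, mul_zero] at ha
  refine Eq.trans (Finset.sum_congr rfl fun t _ => ?_) ha
  split_ifs with hq
  · rw [hq]
  · rw [mul_zero]

lemma bddAbove_smCE (x : Fin T → Bool) (p : Fin T → unitInterval) :
    BddAbove {s : ℝ | ∃ f : unitInterval → ℝ, LipschitzWith 1 f ∧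
      (∀ a, f a ∈ Set.Icc (-1 : ℝ) 1) ∧ s = ∑ t, f (p t) * (bit (x t) - p t)} := by
  refine ⟨∑ _t : Fin T, 1, ?_⟩
  rintro _ ⟨f, _, hf, rfl⟩
  refine Finset.sum_le_sum fun t _ => (le_abs_self _).trans ?_
  rw [abs_mul]
  refine mul_le_one₀ (abs_le.2 (hf _)) (abs_nonneg _) (abs_le.2 ⟨?_, ?_⟩)
  · linarith [bit_nonneg (x t), (p t).2.2]
  · linarith [bit_le_one (x t), (p t).2.1]

/-- The test sum vanishes for a calibrated `q`, and each term `f(p)(x - p)` is 2-Lipschitz in the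
prediction, as both factors are 1-Lipschitz and bounded by 1. -/
lemma smCE_le_two_mul_calDist (x : Fin T → Bool) (p : Fin T → unitInterval) :
    smCE x p ≤ 2 * calDist x p := by
  have hne : {d : ℝ | ∃ q : Fin T → unitInterval, PerfectlyCalibrated x q ∧
      d = ∑ t, |(p t : ℝ) - q t|}.Nonempty := by
    -- Predicting the outcomes themselves is perfectly calibrated, so the infimum is over a nonempty
    -- set.
    refine ⟨_, fun t => ⟨bit (x t), bit_nonneg _, bit_le_one _⟩, fun a => ?_, rfl⟩
    simp
  have hkey : smCE x p / 2 ≤ calDist x p := by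
    refine le_csInf hne ?_
    rintro _ ⟨q, hq, rfl⟩
    rw [div_le_iff₀ two_pos]
    refine csSup_le ⟨_, fun _ => 0, LipschitzWith.const' 0, by simp, rfl⟩ ?_
    rintro _ ⟨f, hf, hf1, rfl⟩
    rw [← sub_zero (∑ t, f (p t) * (bit (x t) - p t)),
      ← sum_mul_sub_eq_zero_of_perfectlyCalibrated hq f, ← Finset.sum_sub_distrib,
      Finset.sum_mul]
    refine Finset.sum_le_sum fun t _ => ?_
    have h1 : |f (p t) - f (q t)| ≤ |(p t : ℝ) - q t| := by
      simpa [Real.dist_eq, Subtype.dist_eq] using hf.dist_le_mul (p t) (q t)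
    have h2 : |bit (x t) - p t| ≤ 1 := abs_le.2
      ⟨by linarith [bit_nonneg (x t), (p t).2.2], by linarith [bit_le_one (x t), (p t).2.1]⟩
    have h3 : |f (q t)| ≤ 1 := abs_le.2 (hf1 _)
    have h4 : f (p t) * (bit (x t) - p t) - f (q t) * (bit (x t) - q t)
        = (f (p t) - f (q t)) * (bit (x t) - p t) + f (q t) * ((q t : ℝ) - p t) := by ring
    rw [h4]
    refine (le_abs_self _).trans ((abs_add_le _ _).trans ?_)
    rw [abs_mul, abs_mul, abs_sub_comm (q t : ℝ), mul_two]
    have h5 := abs_nonneg ((p t : ℝ) - q t)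
    exact add_le_add ((mul_le_of_le_one_right (abs_nonneg _) h2).trans h1)
      (mul_le_of_le_one_left h5 h3)
  linarith

/-! ### The rounds of the forecaster -/

/-- The state of the forecaster after the first `n` outcomes of `x`. -/
def stateAt (p : Fin T → unitInterval) (x : Fin T → Bool) : ℕ → State
  | 0 => State.new 0
  | n + 1 => update p (stateAt p x n) (outcome x n)

/-- A round starts after `t` steps. -/
def RoundStarts (p : Fin T → unitInterval) (x : Fin T → Bool) (t : ℕ) : Prop :=
  stateAt p x t = State.new t

lemma foldl_update_eq_stateAt (p : Fin T → unitInterval) (x : Fin T → Bool) (n : ℕ) :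
    (List.ofFn fun s : Fin n => outcome x s).foldl (update p) (State.new 0) = stateAt p x n := by
  induction n with
  | zero => simp [stateAt]
  | succ n ih =>
    rw [List.ofFn_succ', List.concat_eq_append, List.foldl_append]
    simp only [Fin.val_castSucc, ih, Fin.val_last, List.foldl_cons, List.foldl_nil, stateAt]

lemma run_productForecaster (p : Fin T → unitInterval) (x : Fin T → Bool) (t : Fin T) :
    (run (productForecaster p) x t : ℝ) = predictReal p (stateAt p x t) := by
  have h : history x t = fun s : Fin (t : ℕ) => outcome x s := by
    funext s
    simp [history, outcome, s.isLt.trans t.isLt]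
  rw [run, productForecaster, stateAfter, h, foldl_update_eq_stateAt]
  rfl

/-- The bias of the round starting after `t` steps, after its first half. -/
def firstHalfBias (p : Fin T → unitInterval) (t : ℕ) (x : Fin T → Bool) : ℝ :=
  ∑ j ∈ Finset.range (half T t), (bit (outcome x (t + j)) - alpha p t)

open Classical in
/-- The prediction in step `j` of the round starting after `t` steps, if the round gets there. -/
def roundPrediction (p : Fin T → unitInterval) (t : ℕ) (x : Fin T → Bool) (j : ℕ) : ℝ :=
  if len T t = 1 then 0
  else if FarApart p t ∨ j < half T t then alpha p t
  else beta p t (firstHalfBias p t x)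

/-- The bias after `i` steps of the round starting after `t` steps, if the round gets there. -/
def roundBias (p : Fin T → unitInterval) (t : ℕ) (x : Fin T → Bool) (i : ℕ) : ℝ :=
  ∑ j ∈ Finset.range i, (bit (outcome x (t + j)) - roundPrediction p t x j)

/-- The stopping rule of the round, after `i` of its steps. -/
def RoundStops (p : Fin T → unitInterval) (t : ℕ) (x : Fin T → Bool) (i : ℕ) : Prop :=
  (half T t < i ∧ |roundBias p t x i| ≤ 1) ∨ i = 2 * half T t

/-- The bias does not return to `[-1, 1]` in the second half of the round. -/
def RoundFails (p : Fin T → unitInterval) (t : ℕ) (x : Fin T → Bool) : Prop :=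
  ∀ i, half T t < i → i ≤ 2 * half T t → 1 < |roundBias p t x i|

lemma roundPrediction_mem (p : Fin T → unitInterval) (t : ℕ) (x : Fin T → Bool) (j : ℕ) :
    roundPrediction p t x j ∈ Set.Icc (0 : ℝ) 1 := by
  unfold roundPrediction
  split_ifs
  · simp
  · exact alpha_mem p t
  · exact beta_mem p t _

lemma roundBias_succ (p : Fin T → unitInterval) (t : ℕ) (x : Fin T → Bool) (i : ℕ) :
    roundBias p t x (i + 1) =
      roundBias p t x i + (bit (outcome x (t + i)) - roundPrediction p t x i) :=
  Finset.sum_range_succ _ _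

lemma abs_roundBias_le (p : Fin T → unitInterval) (t : ℕ) (x : Fin T → Bool) (i : ℕ) :
    |roundBias p t x i| ≤ i := by
  refine (Finset.abs_sum_le_sum_abs _ _).trans ?_
  calc _ ≤ ∑ _j ∈ Finset.range i, (1 : ℝ) := Finset.sum_le_sum fun j _ => by
        have h1 := roundPrediction_mem p t x j
        have h2 := bit_nonneg (outcome x (t + j))
        have h3 := bit_le_one (outcome x (t + j))
        exact abs_le.2 ⟨by linarith [h1.2], by linarith [h1.1]⟩
    _ = i := by simp

lemma roundBias_half (p : Fin T → unitInterval) (t : ℕ) (x : Fin T → Bool) (ht : len T t ≠ 1) :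
    roundBias p t x (half T t) = firstHalfBias p t x := by
  refine Finset.sum_congr rfl fun j hj => ?_
  rw [roundPrediction, if_neg ht, if_pos (Or.inr (Finset.mem_range.1 hj))]

open Classical in
/-- The state after `i` steps of a round that has not ended. -/
def roundState (p : Fin T → unitInterval) (t : ℕ) (x : Fin T → Bool) (i : ℕ) : State :=
  ⟨t, i, roundBias p t x i, if half T t ≤ i then roundBias p t x (half T t) else 0⟩

lemma predictReal_roundState (p : Fin T → unitInterval) (t : ℕ) (x : Fin T → Bool) (i : ℕ) :
    predictReal p (roundState p t x i) = roundPrediction p t x i := by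
  unfold predictReal roundPrediction roundState
  dsimp only
  split_ifs with h1 h2 h3
  · rfl
  · rfl
  · rw [roundBias_half p t x h1]
  · exact absurd (Or.inr (not_le.1 h3)) h2

open Classical in
lemma update_roundState (p : Fin T → unitInterval) (t : ℕ) (x : Fin T → Bool) (i : ℕ) :
    update p (roundState p t x i) (outcome x (t + i)) =
      if RoundStops p t x (i + 1) then State.new (t + (i + 1))
      else roundState p t x (i + 1) := by
  have hb : (roundState p t x i).bias +
      (bit (outcome x (t + i)) - (predict p (roundState p t x i) : ℝ)) =
        roundBias p t x (i + 1) := by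
    rw [roundBias_succ, ← predictReal_roundState]; rfl
  unfold update
  dsimp only
  rw [hb]
  by_cases hs : RoundStops p t x (i + 1)
  · exact (if_pos hs).trans (if_pos hs).symm
  refine (if_neg hs).trans (Eq.trans ?_ (if_neg hs).symm)
  dsimp only [roundState]
  congr 1
  by_cases h1 : i + 1 = half T t
  · refine (if_pos h1).trans (Eq.trans ?_ (if_pos h1.ge).symm)
    rw [h1]
  · refine (if_neg h1).trans ?_
    by_cases h2 : half T t ≤ i
    · exact (if_pos h2).trans (if_pos (Nat.le_succ_of_le h2)).symm
    · exact (if_neg h2).trans (if_neg (fun h3 => by omega)).symm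

lemma stateAt_of_not_roundStops {p : Fin T → unitInterval} {t : ℕ} {x : Fin T → Bool}
    (h : RoundStarts p x t) (i : ℕ) (hi : ∀ j, 1 ≤ j → j ≤ i → ¬ RoundStops p t x j) :
    stateAt p x (t + i) = roundState p t x i := by
  induction i with
  | zero =>
    rw [add_zero, h, State.new, roundState]
    congr 1
    split_ifs with h1
    · rw [Nat.le_zero.1 h1]; simp [roundBias]
    · rfl
  | succ i ih =>
    rw [← add_assoc, stateAt, ih fun j h1 h2 => hi j h1 (by omega), update_roundState,
      if_neg (hi _ (by omega) le_rfl)]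

lemma exists_roundStops (p : Fin T → unitInterval) {t : ℕ} (x : Fin T → Bool) (ht : t < T) :
    ∃ n, 1 ≤ n ∧ RoundStops p t x n ∧ n ≤ T - t := by
  rcases Nat.eq_zero_or_pos (half T t) with h | h
  · have hlen : len T t = 1 := by unfold half len at *; omega
    refine ⟨1, le_rfl, Or.inl ⟨by omega, ?_⟩, by omega⟩
    simpa using abs_roundBias_le p t x 1
  · refine ⟨2 * half T t, by omega, Or.inr rfl, ?_⟩
    unfold half len; omega

open Classical in
/-- The bound for the contribution of a round to the distance from calibration. -/
def roundCost (p : Fin T → unitInterval) (t : ℕ) (x : Fin T → Bool) : ℝ :=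
  11 + (if RoundFails p t x then 18 * (half T t : ℝ) else 0) +
    if FarApart p t then 0
    else 8 * (|firstHalfBias p t x| * |alpha p t - beta p t (firstHalfBias p t x)|)

open Classical in
-- A round that stops with a large bias has run through all `2 * half` steps without returning to
-- `[-1, 1]`; then the trivial bound by the number of steps is used.
lemma abs_roundBias_le_of_roundStops {p : Fin T → unitInterval} {t n : ℕ} {x : Fin T → Bool}
    (hn : RoundStops p t x n) (hmin : ∀ j, 1 ≤ j → j < n → ¬ RoundStops p t x j) :
    |roundBias p t x n| ≤ 1 + if RoundFails p t x then 2 * (half T t : ℝ) else 0 := by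
  by_cases h1 : |roundBias p t x n| ≤ 1
  · refine h1.trans ?_
    split_ifs <;> simp
  have h2 : n = 2 * half T t := hn.resolve_left fun h => h1 h.2
  have hf : RoundFails p t x := by
    intro i hi1 hi2
    rcases (h2 ▸ hi2 : i ≤ n).lt_or_eq with h | rfl
    · exact not_le.1 fun h3 => hmin i (by omega) h (Or.inl ⟨hi1, h3⟩)
    · exact not_le.1 h1
  rw [if_pos hf]
  have := abs_roundBias_le p t x n
  rw [h2] at this ⊢
  push_cast at this
  linarith

/-- The predictions of the forecaster, continued beyond the horizon. -/
def prediction (p : Fin T → unitInterval) (x : Fin T → Bool) (s : ℕ) : ℝ :=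
  predictReal p (stateAt p x s)

lemma sum_Ico_shift (f : ℕ → ℝ) (t n : ℕ) :
    ∑ s ∈ Finset.Ico t (t + n), f s = ∑ j ∈ Finset.range n, f (t + j) := by
  rw [Finset.sum_Ico_eq_sum_range, Nat.add_sub_cancel_left]

/-- A round that starts after `t` steps ends after `n` steps, more than half of the remaining ones,
and contributes at most `roundCost` to the distance from calibration. -/
lemma exists_round {p : Fin T → unitInterval} {t : ℕ} {x : Fin T → Bool} (ht : t < T)
    (h : RoundStarts p x t) :
    ∃ n, 1 ≤ n ∧ t + n ≤ T ∧ half T t < n ∧ RoundStarts p x (t + n) ∧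
      (∀ j, 1 ≤ j → j < n → ¬ RoundStarts p x (t + j)) ∧
      CalDistLE (Finset.Ico t (t + n)) (fun s => bit (outcome x s)) (prediction p x)
        (roundCost p t x) := by
  classical
  have hex : ∃ n, 1 ≤ n ∧ RoundStops p t x n := by
    obtain ⟨n, h1, h2, _⟩ := exists_roundStops p x ht
    exact ⟨n, h1, h2⟩
  obtain ⟨n, ⟨hn1, hends⟩, hnT, hmin⟩ : ∃ n, (1 ≤ n ∧ RoundStops p t x n) ∧ n ≤ T - t ∧
      ∀ j, 1 ≤ j → j < n → ¬ RoundStops p t x j := by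
    refine ⟨Nat.find hex, Nat.find_spec hex, ?_, fun j h1 h2 h3 => Nat.find_min hex h2 ⟨h1, h3⟩⟩
    obtain ⟨n, h1, h2, h3⟩ := exists_roundStops p x ht
    exact (Nat.find_min' hex ⟨h1, h2⟩).trans h3
  have hst : ∀ j < n, stateAt p x (t + j) = roundState p t x j := fun j hj =>
    stateAt_of_not_roundStops h j fun i h1 h2 => hmin i h1 (by omega)
  have hpred : ∀ j < n, prediction p x (t + j) = roundPrediction p t x j := fun j hj => by
    rw [prediction, hst j hj, predictReal_roundState]
  have hhalf : half T t < n := by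
    rcases hends with h1 | h1
    · exact h1.1
    · omega
  refine ⟨n, hn1, by omega, hhalf, ?_, ?_, ?_⟩
  · obtain ⟨m, rfl⟩ : ∃ m, n = m + 1 := ⟨n - 1, by omega⟩
    rw [RoundStarts, ← add_assoc, stateAt, hst m (by omega), update_roundState, if_pos hends]
    rfl
  · intro j h1 h2 h3
    have := congrArg State.i ((hst j h2).symm.trans h3)
    simp only [roundState, State.new] at this
    omega
  have hbias := abs_roundBias_le_of_roundStops hends hmin
  have hX : ∀ s, bit (outcome x s) = 0 ∨ bit (outcome x s) = 1 := fun s => bit_eq _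
  have hconst : ∀ γ, (∀ j < n, roundPrediction p t x j = γ) →
      CalDistLE (Finset.Ico t (t + n)) (fun s => bit (outcome x s)) (prediction p x)
        |roundBias p t x n| := fun γ hγ => by
    refine (calDistLE_const hX γ).mono (le_of_eq ?_)
    rw [sum_Ico_shift, sum_Ico_shift, Finset.sum_eq_zero, zero_add, roundBias]
    · congr 1
      exact Finset.sum_congr rfl fun j hj => by rw [hγ j (Finset.mem_range.1 hj)]
    · intro j hj
      rw [hpred j (Finset.mem_range.1 hj), hγ j (Finset.mem_range.1 hj), sub_self, abs_zero]
  have hle : |roundBias p t x n| ≤ roundCost p t x := by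
    unfold roundCost
    refine hbias.trans ?_
    have h8 : (0 : ℝ) ≤ 8 * (|firstHalfBias p t x| *
      |alpha p t - beta p t (firstHalfBias p t x)|) := by positivity
    have hH : (0 : ℝ) ≤ half T t := Nat.cast_nonneg _
    split_ifs <;> linarith
  by_cases hlen : len T t = 1
  · exact (hconst 0 fun j _ => by rw [roundPrediction, if_pos hlen]).mono hle
  by_cases hfar : FarApart p t
  · exact (hconst (alpha p t) fun j _ => by
      rw [roundPrediction, if_neg hlen, if_pos (Or.inl hfar)]).mono hle
  set H := half T t with hH
  obtain ⟨m, rfl⟩ : ∃ m, n = H + m := ⟨n - H, by omega⟩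
  have hun : Finset.Ico t (t + (H + m)) =
      Finset.Ico t (t + H) ∪ Finset.Ico (t + H) (t + H + m) := by
    rw [Finset.Ico_union_Ico_eq_Ico (by omega) (by omega), add_assoc]
  have hA : ∀ s ∈ Finset.Ico t (t + H), prediction p x s = alpha p t := fun s hs => by
    obtain ⟨h1, h2⟩ := Finset.mem_Ico.1 hs
    obtain ⟨j, rfl⟩ := Nat.exists_eq_add_of_le h1
    rw [hpred j (by omega), roundPrediction, if_neg hlen, if_pos (Or.inr (by omega))]
  have hβ : ∀ j < m, roundPrediction p t x (H + j) = beta p t (firstHalfBias p t x) :=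
    fun j hj => by
      rw [roundPrediction, if_neg hlen, if_neg]
      rintro (h1 | h1)
      · exact hfar h1
      · omega
  have hB : ∀ s ∈ Finset.Ico (t + H) (t + H + m),
      prediction p x s = beta p t (firstHalfBias p t x) := fun s hs => by
    obtain ⟨h1, h2⟩ := Finset.mem_Ico.1 hs
    obtain ⟨j, rfl⟩ := Nat.exists_eq_add_of_le h1
    rw [add_assoc, hpred _ (by omega), hβ j (by omega)]
  have key := calDistLE_two_blocks hX (Finset.Ico_disjoint_Ico_consecutive t (t + H) (t + H + m))
    (alpha_mem p t).1 (alpha_mem p t).2 (beta_mem p t (firstHalfBias p t x)).1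
    (beta_mem p t _).2 hA hB
  rw [← hun, sum_Ico_shift, sum_Ico_shift] at key
  have e1 : ∑ j ∈ Finset.range H, (bit (outcome x (t + j)) - alpha p t) = firstHalfBias p t x := rfl
  have e2 : firstHalfBias p t x + ∑ j ∈ Finset.range m,
      (bit (outcome x (t + H + j)) - beta p t (firstHalfBias p t x)) =
        roundBias p t x (H + m) := by
    rw [roundBias, Finset.sum_range_add]
    congr 1
    · exact (roundBias_half p t x hlen).symm
    · exact Finset.sum_congr rfl fun j hj => by
        rw [hβ j (Finset.mem_range.1 hj), add_assoc]
  rw [e1, e2] at key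
  refine key.mono ?_
  unfold roundCost
  rw [if_neg hfar]
  -- The constants of `roundCost` arise here: `11 = 2 + 9` and `18 = 9 * 2`.
  have : 9 * |roundBias p t x (H + m)| ≤ 9 + if RoundFails p t x then 18 * (H : ℝ) else 0 := by
    split_ifs at hbias ⊢ <;> linarith
  linarith

open Classical in
-- Split off the first round and apply induction to the remaining steps, of which at most half are
-- left.
lemma calDistLE_sum_roundCost (p : Fin T → unitInterval) (x : Fin T → Bool) (L t : ℕ)
    (hL : t + L = T) (h : RoundStarts p x t) :
    CalDistLE (Finset.Ico t T) (fun s => bit (outcome x s)) (prediction p x)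
        (∑ s ∈ Finset.Ico t T, if RoundStarts p x s then roundCost p s x else 0) ∧
      (0 < L → ∑ s ∈ Finset.Ico t T, (if RoundStarts p x s then 1 else 0) ≤ Nat.log 2 L + 1) := by
  induction L using Nat.strong_induction_on generalizing t with
  | _ L ih =>
  rcases Nat.eq_zero_or_pos L with rfl | hpos
  · rw [add_zero] at hL
    subst hL
    simpa using CalDistLE.empty
  obtain ⟨n, hn1, hnT, hhalf, hnext, hbetween, hcal⟩ := exists_round (by omega) h
  obtain ⟨ih1, ih2⟩ := ih (L - n) (by omega) (t + n) (by omega) hnext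
  have hun : Finset.Ico t T = Finset.Ico t (t + n) ∪ Finset.Ico (t + n) T :=
    (Finset.Ico_union_Ico_eq_Ico (by omega) (by omega)).symm
  have hdis := Finset.Ico_disjoint_Ico_consecutive t (t + n) T
  have hsum : ∀ (f : ℕ → ℝ), ∑ s ∈ Finset.Ico t (t + n), (if RoundStarts p x s then f s else 0)
      = f t := fun f => by
    rw [Finset.sum_eq_single t, if_pos h]
    · intro s hs hst
      obtain ⟨h1, h2⟩ := Finset.mem_Ico.1 hs
      obtain ⟨j, rfl⟩ := Nat.exists_eq_add_of_le h1
      rw [if_neg (hbetween j (by omega) (by omega))]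
    · intro h0
      exact absurd (Finset.mem_Ico.2 ⟨le_rfl, by omega⟩) h0
  refine ⟨?_, fun _ => ?_⟩
  · rw [hun, Finset.sum_union hdis, hsum]
    exact hcal.union ih1 hdis
  · have hcount : ∑ s ∈ Finset.Ico t (t + n), (if RoundStarts p x s then 1 else 0) = 1 := by
      have := hsum fun _ => 1
      exact_mod_cast this
    rw [hun, Finset.sum_union hdis, hcount]
    rcases Nat.eq_zero_or_pos (L - n) with h0 | h0
    · rw [Finset.Ico_eq_empty (by omega)]
      simp
    · have h1 := ih2 h0
      have h2 : L - n ≤ L / 2 := by unfold half len at hhalf; omega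
      have h3 : Nat.log 2 L = Nat.log 2 (L / 2) + 1 := by
        rw [Nat.log_div_base]
        have : 0 < Nat.log 2 L := Nat.log_pos one_lt_two (by omega)
        omega
      have h4 := Nat.log_mono_right (b := 2) h2
      omega

open Classical in
lemma calDist_run_le (p : Fin T → unitInterval) (x : Fin T → Bool) :
    calDist x (run (productForecaster p) x) ≤
      ∑ s ∈ Finset.range T, if RoundStarts p x s then roundCost p s x else 0 := by
  have h := (calDistLE_sum_roundCost p x T 0 (zero_add T) rfl).1
  rw [Nat.Ico_zero_eq_range] at h
  exact calDist_le_of_calDistLE (fun t => (run_productForecaster p x t).symm) h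

open Classical in
lemma sum_roundStarts_le (p : Fin T → unitInterval) (x : Fin T → Bool) (hT : 0 < T) :
    ∑ s ∈ Finset.range T, (if RoundStarts p x s then 1 else 0) ≤ Nat.log 2 T + 1 := by
  have h := (calDistLE_sum_roundCost p x T 0 (zero_add T) rfl).2 hT
  rwa [Nat.Ico_zero_eq_range] at h

/-! ### The expected cost of a round -/

lemma half_mul_muFirst (p : Fin T → unitInterval) {t : ℕ} (hH : 0 < half T t) :
    half T t * muFirst p t = ∑ j ∈ Finset.range (half T t), param p (t + j) := by
  have : (half T t : ℝ) ≠ 0 := by exact_mod_cast hH.ne'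
  rw [muFirst]; field_simp

lemma half_mul_muSecond (p : Fin T → unitInterval) {t : ℕ} (hH : 0 < half T t) :
    half T t * muSecond p t =
      ∑ j ∈ Finset.range (half T t), param p (t + half T t + j) := by
  have : (half T t : ℝ) ≠ 0 := by exact_mod_cast hH.ne'
  rw [muSecond]; field_simp

lemma firstHalfBias_eq (p : Fin T → unitInterval) {t : ℕ} (hH : 0 < half T t)
    (x : Fin T → Bool) :
    firstHalfBias p t x =
      deviation p t (half T t) x + half T t * (muFirst p t - alpha p t) := by
  rw [mul_sub, half_mul_muFirst p hH, firstHalfBias, deviation]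
  simp only [Finset.sum_sub_distrib, Finset.sum_const, Finset.card_range, nsmul_eq_mul]
  ring

lemma deviation_add_mem (p : Fin T → unitInterval) {t : ℕ} (hH : 0 < half T t)
    (x : Fin T → Bool) :
    deviation p t (half T t) x + half T t * muFirst p t ∈ Set.Icc (0 : ℝ) (half T t) := by
  rw [half_mul_muFirst p hH, deviation, Finset.sum_sub_distrib, sub_add_cancel]
  refine ⟨Finset.sum_nonneg fun _ _ => bit_nonneg _, ?_⟩
  simpa using Finset.sum_le_sum fun j (_ : j ∈ Finset.range (half T t)) =>
    bit_le_one (outcome x (t + j))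

/-! ### The bias cannot jump over `[-1, 1]` -/

lemma abs_roundBias_succ_sub_le (p : Fin T → unitInterval) (t : ℕ) (x : Fin T → Bool) (i : ℕ) :
    |roundBias p t x (i + 1) - roundBias p t x i| ≤ 1 := by
  rw [roundBias_succ, add_sub_cancel_left]
  have h1 := roundPrediction_mem p t x i
  exact abs_le.2 ⟨by linarith [h1.2, bit_nonneg (outcome x (t + i))],
    by linarith [h1.1, bit_le_one (outcome x (t + i))]⟩

lemma RoundFails.one_lt {p : Fin T → unitInterval} {t : ℕ} {x : Fin T → Bool}
    (hf : RoundFails p t x) (h0 : 0 ≤ roundBias p t x (half T t)) {i : ℕ} (hi : half T t < i)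
    (hi2 : i ≤ 2 * half T t) : 1 < roundBias p t x i := by
  induction i, hi using Nat.le_induction with
  | base =>
    have h1 := hf _ (Nat.lt_succ_self _) hi2
    have h2 := abs_le.1 (abs_roundBias_succ_sub_le p t x (half T t))
    rcases lt_abs.1 h1 with h | h
    · exact h
    · linarith [h2.1]
  | succ i hi ih =>
    have h1 := hf (i + 1) (by omega) hi2
    have h2 := abs_le.1 (abs_roundBias_succ_sub_le p t x i)
    have h3 := ih (by omega)
    rcases lt_abs.1 h1 with h | h
    · exact h
    · linarith [h2.1]

lemma RoundFails.lt_neg_one {p : Fin T → unitInterval} {t : ℕ} {x : Fin T → Bool}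
    (hf : RoundFails p t x) (h0 : roundBias p t x (half T t) ≤ 0) {i : ℕ} (hi : half T t < i)
    (hi2 : i ≤ 2 * half T t) : roundBias p t x i < -1 := by
  induction i, hi using Nat.le_induction with
  | base =>
    have h1 := hf _ (Nat.lt_succ_self _) hi2
    have h2 := abs_le.1 (abs_roundBias_succ_sub_le p t x (half T t))
    rcases lt_abs.1 h1 with h | h
    · linarith [h2.2]
    · linarith
  | succ i hi ih =>
    have h1 := hf (i + 1) (by omega) hi2
    have h2 := abs_le.1 (abs_roundBias_succ_sub_le p t x i)
    have h3 := ih (by omega)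
    rcases lt_abs.1 h1 with h | h
    · linarith [h2.2]
    · linarith

lemma len_ne_one_of_half_pos {t : ℕ} (hH : 0 < half T t) : len T t ≠ 1 := by
  unfold half at hH; omega

lemma log_len_pos {t : ℕ} (hH : 0 < half T t) : 0 < Real.log (len T t) := by
  apply Real.log_pos
  have : 1 < len T t := by unfold half at hH; omega
  exact_mod_cast this

lemma exp_neg_log_len {t : ℕ} (hH : 0 < half T t) :
    Real.exp (-Real.log (len T t)) = 1 / (len T t : ℝ) := by
  have : 0 < len T t := by unfold half at hH; omega
  rw [Real.exp_neg, Real.exp_log (by exact_mod_cast this), one_div]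

lemma two_mul_half_add_le {t : ℕ} (hH : 0 < half T t) : t + 2 * half T t ≤ T := by
  unfold half len at *; omega

/-! ### Failure when the half averages are far apart -/

lemma roundBias_of_farApart {p : Fin T → unitInterval} {t : ℕ} (hH : 0 < half T t)
    (hfar : FarApart p t) (x : Fin T → Bool) :
    roundBias p t x (half T t) =
      deviation p t (half T t) x + half T t * ((muFirst p t - mu p t) / 2) ∧
    roundBias p t x (2 * half T t) =
      deviation p t (2 * half T t) x - half T t * (muFirst p t - mu p t) := by
  have hα : alpha p t = (muFirst p t + mu p t) / 2 := by rw [alpha, if_pos hfar]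
  constructor
  · rw [roundBias_half p t x (len_ne_one_of_half_pos hH), firstHalfBias_eq p hH, hα]
    ring
  · have h1 : roundBias p t x (2 * half T t) =
        ∑ j ∈ Finset.range (2 * half T t), (bit (outcome x (t + j)) - alpha p t) :=
      Finset.sum_congr rfl fun j _ => by
        rw [roundPrediction, if_neg (len_ne_one_of_half_pos hH), if_pos (Or.inl hfar)]
    have h2 : ∑ j ∈ Finset.range (2 * half T t), param p (t + j) = 2 * half T t * mu p t := by
      rw [two_mul, Finset.sum_range_add, ← half_mul_muFirst p hH]
      simp only [← add_assoc]
      rw [← half_mul_muSecond p hH, mu]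
      ring
    rw [h1, deviation, hα]
    simp only [Finset.sum_sub_distrib, Finset.sum_const, Finset.card_range, nsmul_eq_mul]
    rw [h2]
    push_cast
    ring

/-- The drift is `H(μ₁ - μ)/2` after one half and `-H(μ₁ - μ)` after two. If the bias does not
change sign in between, one of the two deviations outweighs its drift, and the threshold for
`FarApart` makes each of these events have probability at most `1/L`. -/
lemma prob_roundFails_of_farApart {p : Fin T → unitInterval} {t : ℕ} (hH : 0 < half T t)
    (hfar : FarApart p t) :
    (productBernoulli p).real {x | RoundFails p t x} ≤ 2 * (1 / (len T t : ℝ)) := by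
  set H := half T t with hHdef
  have hH0 : (0 : ℝ) < H := by exact_mod_cast hH
  set l := Real.log (len T t) with hl
  have hlpos : 0 < l := log_len_pos hH
  set r := Real.sqrt (2 * l / H) with hr
  have hr0 : 0 ≤ r := Real.sqrt_nonneg _
  have hr2 : r ^ 2 = 2 * l / H := Real.sq_sqrt (by positivity)
  have hT := two_mul_half_add_le hH
  rw [← hHdef] at hT
  rw [← exp_neg_log_len hH, ← hl]
  have e1 : Real.exp (-(2 * (H * r / 2) ^ 2 / H)) = Real.exp (-l) := by
    congr 2
    rw [div_pow, mul_pow, hr2]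
    field_simp
  have e2 : Real.exp (-(2 * (H * r) ^ 2 / (2 * H : ℕ))) ≤ Real.exp (-l) := by
    apply Real.exp_le_exp.2
    have : 2 * (H * r) ^ 2 / (2 * H : ℕ) = 2 * l := by
      rw [mul_pow, hr2]; push_cast; field_simp
    rw [this]; linarith
  have hfar' : r ≤ |muFirst p t - mu p t| := hfar
  rcases le_abs.1 hfar' with hd | hd
  · calc (productBernoulli p).real {x | RoundFails p t x}
        ≤ (productBernoulli p).real ({x | deviation p t H x ≤ -(H * r / 2)} ∪
            {x | H * r ≤ deviation p t (2 * H) x}) := by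
          refine measureReal_mono fun x hx => ?_
          obtain ⟨b1, b2⟩ := roundBias_of_farApart hH hfar x
          have hm := mul_le_mul_of_nonneg_left hd hH0.le
          rcases lt_or_ge (roundBias p t x H) 0 with h0 | h0
          · left
            rw [b1] at h0
            simp only [Set.mem_ofPred_eq]
            linarith
          · right
            have := RoundFails.one_lt hx h0 (i := 2 * H) (by omega) le_rfl
            rw [b2] at this
            simp only [Set.mem_ofPred_eq]
            linarith
      _ ≤ _ := (measureReal_union_le _ _).trans (by
          have h1 := prob_deviation_le_neg p (a := t) (n := H) (by omega)
            (ε := H * r / 2) (by positivity)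
          have h2 := prob_deviation_ge p (a := t) (n := 2 * H) (by omega)
            (ε := H * r) (by positivity)
          rw [e1] at h1
          linarith)
  · calc (productBernoulli p).real {x | RoundFails p t x}
        ≤ (productBernoulli p).real ({x | H * r / 2 ≤ deviation p t H x} ∪
            {x | deviation p t (2 * H) x ≤ -(H * r)}) := by
          refine measureReal_mono fun x hx => ?_
          obtain ⟨b1, b2⟩ := roundBias_of_farApart hH hfar x
          have hm := mul_le_mul_of_nonneg_left hd hH0.le
          rcases lt_or_ge 0 (roundBias p t x H) with h0 | h0
          · left
            rw [b1] at h0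
            simp only [Set.mem_ofPred_eq]
            linarith
          · right
            have := RoundFails.lt_neg_one hx h0 (i := 2 * H) (by omega) le_rfl
            rw [b2] at this
            simp only [Set.mem_ofPred_eq]
            linarith
      _ ≤ _ := (measureReal_union_le _ _).trans (by
          have h1 := prob_deviation_ge p (a := t) (n := H) (by omega)
            (ε := H * r / 2) (by positivity)
          have h2 := prob_deviation_le_neg p (a := t) (n := 2 * H) (by omega)
            (ε := H * r) (by positivity)
          rw [e1] at h1
          linarith)

/-! ### Failure when the half averages are close -/

lemma roundBias_of_not_farApart {p : Fin T → unitInterval} {t : ℕ} (hH : 0 < half T t)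
    (hfar : ¬ FarApart p t) (x : Fin T → Bool) :
    roundBias p t x (2 * half T t) = firstHalfBias p t x + deviation p (t + half T t) (half T t) x
      + half T t * (muSecond p t - beta p t (firstHalfBias p t x)) ∧
    roundBias p t x (half T t + 1) = firstHalfBias p t x +
      (bit (outcome x (t + half T t)) - beta p t (firstHalfBias p t x)) := by
  have hβ : ∀ j, roundPrediction p t x (half T t + j) = beta p t (firstHalfBias p t x) :=
    fun j => by
      rw [roundPrediction, if_neg (len_ne_one_of_half_pos hH), if_neg]
      rintro (h1 | h1)
      · exact hfar h1
      · omega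
  constructor
  · have h1 : roundBias p t x (2 * half T t) = roundBias p t x (half T t) +
        ∑ j ∈ Finset.range (half T t), (bit (outcome x (t + half T t + j)) -
          beta p t (firstHalfBias p t x)) := by
      rw [two_mul, roundBias, Finset.sum_range_add]
      refine congrArg₂ _ rfl (Finset.sum_congr rfl fun j _ => ?_)
      rw [hβ, add_assoc]
    rw [h1, roundBias_half p t x (len_ne_one_of_half_pos hH), mul_sub, half_mul_muSecond p hH,
      deviation]
    simp only [Finset.sum_sub_distrib, Finset.sum_const, Finset.card_range, nsmul_eq_mul]
    ring
  · rw [roundBias_succ, roundBias_half p t x (len_ne_one_of_half_pos hH), ← hβ 0, add_zero]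

lemma sqrt_le_mul_sqrt {a b c : ℝ} (hc : 0 ≤ c) (h : a ≤ c ^ 2 * b) :
    Real.sqrt a ≤ c * Real.sqrt b := by
  calc Real.sqrt a ≤ Real.sqrt (c ^ 2 * b) := Real.sqrt_le_sqrt h
    _ = c * Real.sqrt b := by rw [Real.sqrt_mul (sq_nonneg c), Real.sqrt_sq hc]

lemma abs_muFirst_sub_muSecond_le {p : Fin T → unitInterval} {t : ℕ} (hH : 0 < half T t)
    (hfar : ¬ FarApart p t) :
    |muFirst p t - muSecond p t| ≤ 3 * Real.sqrt (Real.log (len T t) / half T t) := by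
  have hH0 : (0 : ℝ) < half T t := by exact_mod_cast hH
  have hl := log_len_pos hH
  have h1 : |muFirst p t - mu p t| ≤ Real.sqrt (2 * Real.log (len T t) / half T t) :=
    (not_le.1 hfar).le
  have h2 : muFirst p t - mu p t = (muFirst p t - muSecond p t) / 2 := by rw [mu]; ring
  rw [h2, abs_div, abs_two] at h1
  have h3 : Real.sqrt (2 * Real.log (len T t) / half T t) ≤
      3 / 2 * Real.sqrt (Real.log (len T t) / half T t) := by
    refine sqrt_le_mul_sqrt (by norm_num) ?_
    rw [mul_div_assoc]
    have : 0 ≤ Real.log (len T t) / half T t := by positivity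
    linarith
  linarith

lemma sqrt_log_div_two_mul_le {t : ℕ} (hH : 0 < half T t) :
    Real.sqrt (Real.log (len T t) / (2 * half T t)) ≤
      Real.sqrt (Real.log (len T t) / half T t) := by
  have hH0 : (0 : ℝ) < half T t := by exact_mod_cast hH
  have hl := log_len_pos hH
  apply Real.sqrt_le_sqrt
  gcongr
  linarith

/-- Write `v = √(log L / H)`. If `β` is not cut off, failure needs a second-half deviation beating
the overshoot. If `β = 1`, then `Δ ≥ H(1 - μ₁ - 4v)`. This forces a first-half deviation of at least
`Hv`, except when `μ₁` is within `10v` of 1; there `α` exceeds `μ₁` by the third threshold or equals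
1. -/
lemma roundFails_subset_of_nonneg {p : Fin T → unitInterval} {t : ℕ} (hH : 0 < half T t)
    (hfar : ¬ FarApart p t) (hv : Real.sqrt (Real.log (len T t) / half T t) ≤ 1 / 40)
    {x : Fin T → Bool} (hf : RoundFails p t x) (h0 : 0 ≤ firstHalfBias p t x) :
    half T t * Real.sqrt (Real.log (len T t) / (2 * half T t)) ≤
        deviation p (t + half T t) (half T t) x ∨
      half T t * Real.sqrt (Real.log (len T t) / half T t) ≤ deviation p t (half T t) x ∨
      (muFirst p t < 1 ∧
        half T t * Real.sqrt (2 * (1 - muFirst p t) * Real.log (len T t) / half T t) ≤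
          deviation p t (half T t) x) := by
  obtain ⟨b1, b2⟩ := roundBias_of_not_farApart hH hfar x
  have hstart : 0 ≤ roundBias p t x (half T t) := by
    rwa [roundBias_half p t x (len_ne_one_of_half_pos hH)]
  have f1 := hf.one_lt hstart (i := half T t + 1) (by omega) (by omega)
  have f2 := hf.one_lt hstart (i := 2 * half T t) (by omega) le_rfl
  rw [b2] at f1
  rw [b1] at f2
  have hβ : beta p t (firstHalfBias p t x) = min (muSecond p t + firstHalfBias p t x / half T t +
      Real.sqrt (Real.log (len T t) / (2 * half T t))) 1 := by rw [beta, if_pos h0]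
  have hdiff := abs_le.1 (abs_muFirst_sub_muSecond_le hH hfar)
  have hs := sqrt_log_div_two_mul_le hH
  have hW := deviation_add_mem p hH x
  have hbias := firstHalfBias_eq p hH x
  have hH0 : (0 : ℝ) < half T t := by exact_mod_cast hH
  have hbit := bit_le_one (outcome x (t + half T t))
  have hμ := muFirst_mem p t
  have hα := alpha.eq_1 p t
  rw [if_neg hfar] at hα
  set H : ℝ := (half T t : ℝ)
  set v := Real.sqrt (Real.log (len T t) / H)
  have hv0 : 0 ≤ v := Real.sqrt_nonneg _
  set s := Real.sqrt (Real.log (len T t) / (2 * H))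
  set Δ := firstHalfBias p t x
  set W := deviation p t (half T t) x
  rcases le_or_gt (muSecond p t + Δ / H + s) 1 with hc | hc
  · left
    rw [hβ, min_eq_left hc] at f2
    have : H * (muSecond p t - (muSecond p t + Δ / H + s)) = -Δ - H * s := by
      field_simp; ring
    rw [this] at f2
    linarith
  right
  rw [hβ, min_eq_right hc.le] at f1
  have hΔ : 1 < Δ := by linarith
  have hΔH : H * (1 - muFirst p t - 4 * v) ≤ Δ := by
    have h1 : 1 - muFirst p t - 4 * v ≤ Δ / H := by linarith [hdiff.1]
    have := mul_le_mul_of_nonneg_left h1 hH0.le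
    rwa [mul_div_cancel₀ _ hH0.ne'] at this
  have hα0 := (alpha_mem p t).1
  split_ifs at hα with c1 c2 c3
  · left
    rw [hα, sub_self, mul_zero, add_zero] at hbias
    have : H * v ≤ H * (1 - muFirst p t - 4 * v) := by
      apply mul_le_mul_of_nonneg_left _ hH0.le; linarith
    linarith
  · left
    -- Here `α` was lowered, but by no more than `μ₁ < 10v`; since `v ≤ 1/40`, the bias is still far
    -- below what the cut-off of `β` requires.
    have h1 : Δ ≤ W + H * muFirst p t := by
      rw [hbias]
      have := mul_le_mul_of_nonneg_left (sub_le_self (muFirst p t) hα0) hH0.le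
      linarith
    have : H * v ≤ H * (1 - muFirst p t - 4 * v - muFirst p t) := by
      apply mul_le_mul_of_nonneg_left _ hH0.le
      have := not_le.1 c2
      linarith
    linarith
  · left
    rw [hα, sub_self, mul_zero, add_zero] at hbias
    have : H * v ≤ H * (1 - muFirst p t - 4 * v) := by
      apply mul_le_mul_of_nonneg_left _ hH0.le; linarith
    linarith
  · right
    rcases le_or_gt 1 (muFirst p t +
      Real.sqrt (2 * (1 - muFirst p t) * Real.log (len T t) / H)) with h1 | h1
    -- With `α = 1` the bias of the first half cannot be positive.
    · rw [min_eq_right h1] at hα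
      rw [hα] at hbias
      linarith [hW.2]
    · rw [min_eq_left h1.le] at hα
      rw [hα] at hbias
      have h2 := Real.sqrt_nonneg (2 * (1 - muFirst p t) * Real.log (len T t) / H)
      exact ⟨by linarith, by linarith⟩

lemma roundFails_subset_of_neg {p : Fin T → unitInterval} {t : ℕ} (hH : 0 < half T t)
    (hfar : ¬ FarApart p t) (hv : Real.sqrt (Real.log (len T t) / half T t) ≤ 1 / 40)
    {x : Fin T → Bool} (hf : RoundFails p t x) (h0 : firstHalfBias p t x < 0) :
    deviation p (t + half T t) (half T t) x ≤
        -(half T t * Real.sqrt (Real.log (len T t) / (2 * half T t))) ∨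
      deviation p t (half T t) x ≤
        -(half T t * Real.sqrt (Real.log (len T t) / half T t)) ∨
      (0 < muFirst p t ∧ deviation p t (half T t) x ≤
        -(half T t * Real.sqrt (2 * muFirst p t * Real.log (len T t) / half T t))) := by
  obtain ⟨b1, b2⟩ := roundBias_of_not_farApart hH hfar x
  have hstart : roundBias p t x (half T t) ≤ 0 := by
    rw [roundBias_half p t x (len_ne_one_of_half_pos hH)]; exact h0.le
  have f1 := hf.lt_neg_one hstart (i := half T t + 1) (by omega) (by omega)
  have f2 := hf.lt_neg_one hstart (i := 2 * half T t) (by omega) le_rfl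
  rw [b2] at f1
  rw [b1] at f2
  have hβ : beta p t (firstHalfBias p t x) = max (muSecond p t + firstHalfBias p t x / half T t -
      Real.sqrt (Real.log (len T t) / (2 * half T t))) 0 := by rw [beta, if_neg (not_le.2 h0)]
  have hdiff := abs_le.1 (abs_muFirst_sub_muSecond_le hH hfar)
  have hs := sqrt_log_div_two_mul_le hH
  have hW := deviation_add_mem p hH x
  have hbias := firstHalfBias_eq p hH x
  have hH0 : (0 : ℝ) < half T t := by exact_mod_cast hH
  have hbit := bit_nonneg (outcome x (t + half T t))
  have hμ := muFirst_mem p t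
  have hα := alpha.eq_1 p t
  rw [if_neg hfar] at hα
  set H : ℝ := (half T t : ℝ)
  set v := Real.sqrt (Real.log (len T t) / H)
  have hv0 : 0 ≤ v := Real.sqrt_nonneg _
  set s := Real.sqrt (Real.log (len T t) / (2 * H))
  set Δ := firstHalfBias p t x
  set W := deviation p t (half T t) x
  rcases le_or_gt 0 (muSecond p t + Δ / H - s) with hc | hc
  · left
    rw [hβ, max_eq_left hc] at f2
    have : H * (muSecond p t - (muSecond p t + Δ / H - s)) = -Δ + H * s := by
      field_simp; ring
    rw [this] at f2
    linarith
  right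
  rw [hβ, max_eq_right hc.le] at f1
  have hΔ : Δ < -1 := by linarith
  have hΔH : H * (muFirst p t - 4 * v) ≤ -Δ := by
    have h1 : muFirst p t - 4 * v ≤ -Δ / H := by rw [neg_div]; linarith [hdiff.2]
    have := mul_le_mul_of_nonneg_left h1 hH0.le
    rwa [mul_div_cancel₀ _ hH0.ne'] at this
  have hα1 := (alpha_mem p t).2
  split_ifs at hα with c1 c2 c3
  · left
    rw [hα, sub_self, mul_zero, add_zero] at hbias
    have : H * v ≤ H * (muFirst p t - 4 * v) := by
      apply mul_le_mul_of_nonneg_left _ hH0.le; linarith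
    linarith
  · right
    rcases le_or_gt (muFirst p t -
      Real.sqrt (2 * muFirst p t * Real.log (len T t) / H)) 0 with h1 | h1
    · rw [max_eq_right h1] at hα
      rw [hα] at hbias
      linarith [hW.1]
    · rw [max_eq_left h1.le] at hα
      rw [hα] at hbias
      have h2 := Real.sqrt_nonneg (2 * muFirst p t * Real.log (len T t) / H)
      exact ⟨by linarith, by linarith⟩
  · left
    rw [hα, sub_self, mul_zero, add_zero] at hbias
    have : H * v ≤ H * (muFirst p t - 4 * v) := by
      apply mul_le_mul_of_nonneg_left _ hH0.le; linarith
    linarith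
  · left
    have h1 : -Δ ≤ -W + H * (1 - muFirst p t) := by
      rw [hbias]
      have := mul_le_mul_of_nonneg_left (sub_le_sub_right hα1 (muFirst p t)) hH0.le
      linarith
    have : H * v ≤ H * (muFirst p t - 4 * v - (1 - muFirst p t)) := by
      apply mul_le_mul_of_nonneg_left _ hH0.le
      have := not_le.1 c3
      linarith
    linarith

lemma prob_roundFails_of_not_farApart {p : Fin T → unitInterval} {t : ℕ} (hH : 0 < half T t)
    (hfar : ¬ FarApart p t) (hv : Real.sqrt (Real.log (len T t) / half T t) ≤ 1 / 40) :
    (productBernoulli p).real {x | RoundFails p t x} ≤ 6 * (1 / (len T t : ℝ)) := by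
  have hT := two_mul_half_add_le hH
  rw [← exp_neg_log_len hH]
  have hH0 : (0 : ℝ) < half T t := by exact_mod_cast hH
  have hl := log_len_pos hH
  have hμ := muFirst_mem p t
  set l := Real.log (len T t)
  set H := half T t with hHdef
  have hs2 : Real.sqrt (l / (2 * H)) ^ 2 = l / (2 * H) := Real.sq_sqrt (by positivity)
  have hv2 : Real.sqrt (l / H) ^ 2 = l / H := Real.sq_sqrt (by positivity)
  have es : Real.exp (-(2 * (H * Real.sqrt (l / (2 * H))) ^ 2 / H)) = Real.exp (-l) := by
    rw [mul_pow, hs2]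
    congr 2
    field_simp
  have ev : Real.exp (-(2 * (H * Real.sqrt (l / H)) ^ 2 / H)) ≤ Real.exp (-l) := by
    rw [mul_pow, hv2]
    apply Real.exp_le_exp.2
    have : 2 * ((H : ℝ) ^ 2 * (l / H)) / H = 2 * l := by field_simp
    rw [this]; linarith
  have hs0 := Real.sqrt_nonneg (l / (2 * H))
  have hv0 := Real.sqrt_nonneg (l / H)
  have p1 := prob_deviation_ge p (a := t + H) (n := H) (by omega)
    (ε := H * Real.sqrt (l / (2 * H))) (by positivity)
  have p2 := prob_deviation_ge p (a := t) (n := H) (by omega)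
    (ε := H * Real.sqrt (l / H)) (by positivity)
  have p4 := prob_deviation_le_neg p (a := t + H) (n := H) (by omega)
    (ε := H * Real.sqrt (l / (2 * H))) (by positivity)
  have p5 := prob_deviation_le_neg p (a := t) (n := H) (by omega)
    (ε := H * Real.sqrt (l / H)) (by positivity)
  rw [es] at p1 p4
  have p3 : (productBernoulli p).real {x | muFirst p t < 1 ∧
      H * Real.sqrt (2 * (1 - muFirst p t) * l / H) ≤ deviation p t H x} ≤ Real.exp (-l) := by
    -- For `μ₁ = 1` the variance proxy would be 0; the strict inequality kept in the event makes it
    -- empty then.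
    by_cases hμ1 : muFirst p t < 1
    · have hpos : 0 < 1 - muFirst p t := by linarith
      have := prob_deviation_ge_of_params p (a := t) (n := H) (by omega)
        (ε := H * Real.sqrt (2 * (1 - muFirst p t) * l / H)) (v := H * (1 - muFirst p t))
        (by positivity) (by positivity) (by
          rw [mul_sub, half_mul_muFirst p hH]; simp [Finset.sum_sub_distrib, hHdef])
      simp only [hμ1, true_and]
      refine this.trans (le_of_eq ?_)
      rw [mul_pow, Real.sq_sqrt (by positivity)]
      congr 2
      field_simp
    · simp only [hμ1, false_and, Set.ofPred_false, measureReal_empty]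
      positivity
  have p6 : (productBernoulli p).real {x | 0 < muFirst p t ∧
      deviation p t H x ≤ -(H * Real.sqrt (2 * muFirst p t * l / H))} ≤ Real.exp (-l) := by
    by_cases hμ0 : 0 < muFirst p t
    · have := prob_deviation_le_neg_of_params p (a := t) (n := H) (by omega)
        (ε := H * Real.sqrt (2 * muFirst p t * l / H)) (v := H * muFirst p t)
        (by positivity) (by positivity) (by rw [half_mul_muFirst p hH])
      simp only [hμ0, true_and]
      refine this.trans (le_of_eq ?_)
      rw [mul_pow, Real.sq_sqrt (by positivity)]
      congr 2
      field_simp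
    · simp only [hμ0, false_and, Set.ofPred_false, measureReal_empty]
      positivity
  have hsub : {x | RoundFails p t x} ⊆
      ({x | H * Real.sqrt (l / (2 * H)) ≤ deviation p (t + H) H x} ∪
        ({x | H * Real.sqrt (l / H) ≤ deviation p t H x} ∪
          {x | muFirst p t < 1 ∧
            H * Real.sqrt (2 * (1 - muFirst p t) * l / H) ≤ deviation p t H x})) ∪
      ({x | deviation p (t + H) H x ≤ -(H * Real.sqrt (l / (2 * H)))} ∪
        ({x | deviation p t H x ≤ -(H * Real.sqrt (l / H))} ∪
          {x | 0 < muFirst p t ∧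
            deviation p t H x ≤ -(H * Real.sqrt (2 * muFirst p t * l / H))})) := by
    intro x hx
    rcases le_or_gt 0 (firstHalfBias p t x) with h0 | h0
    · exact Or.inl (roundFails_subset_of_nonneg hH hfar hv hx h0)
    · exact Or.inr (roundFails_subset_of_neg hH hfar hv hx h0)
  refine (measureReal_mono hsub).trans ((measureReal_union_le _ _).trans ?_)
  have u1 := measureReal_union_le (μ := productBernoulli p)
    {x | H * Real.sqrt (l / (2 * H)) ≤ deviation p (t + H) H x}
    ({x | H * Real.sqrt (l / H) ≤ deviation p t H x} ∪
      {x | muFirst p t < 1 ∧ H * Real.sqrt (2 * (1 - muFirst p t) * l / H) ≤ deviation p t H x})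
  have u2 := measureReal_union_le (μ := productBernoulli p)
    {x | H * Real.sqrt (l / H) ≤ deviation p t H x}
    {x | muFirst p t < 1 ∧ H * Real.sqrt (2 * (1 - muFirst p t) * l / H) ≤ deviation p t H x}
  have u3 := measureReal_union_le (μ := productBernoulli p)
    {x | deviation p (t + H) H x ≤ -(H * Real.sqrt (l / (2 * H)))}
    ({x | deviation p t H x ≤ -(H * Real.sqrt (l / H))} ∪
      {x | 0 < muFirst p t ∧ deviation p t H x ≤ -(H * Real.sqrt (2 * muFirst p t * l / H))})
  have u4 := measureReal_union_le (μ := productBernoulli p)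
    {x | deviation p t H x ≤ -(H * Real.sqrt (l / H))}
    {x | 0 < muFirst p t ∧ deviation p t H x ≤ -(H * Real.sqrt (2 * muFirst p t * l / H))}
  linarith

/-! ### Moments of the bias and the distance between the two predictions -/

lemma log_len_pow_le {t : ℕ} (hH : 0 < half T t) (k : ℕ) :
    Real.log (len T t) ^ k ≤ 3 * k.factorial * half T t := by
  have hl := log_len_pos hH
  have h := Real.pow_div_factorial_le_exp _ hl.le k
  have hL : len T t ≤ 3 * half T t := by unfold half at *; omega
  have hL0 : 0 < len T t := by unfold half at hH; omega
  rw [Real.exp_log (by exact_mod_cast hL0), div_le_iff₀ (by positivity)] at h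
  have hL' : (len T t : ℝ) ≤ 3 * half T t := by exact_mod_cast hL
  calc _ ≤ (len T t : ℝ) * k.factorial := h
    _ ≤ 3 * half T t * k.factorial := by gcongr
    _ = _ := by ring

/-- The failure probability `O(1/L)` pays for the trivial cost `O(H)`. It is not available for close
half averages with `√(log L / H) > 1/40`, but then `H` itself is bounded. -/
lemma half_mul_prob_roundFails_le (p : Fin T → unitInterval) {t : ℕ} (hH : 0 < half T t) :
    half T t * (productBernoulli p).real {x | RoundFails p t x} ≤ 16000000 := by
  have hH0 : (0 : ℝ) < half T t := by exact_mod_cast hH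
  have hL : (2 * half T t : ℝ) ≤ len T t := by
    have : 2 * half T t ≤ len T t := by unfold half; omega
    exact_mod_cast this
  have hsmall : ∀ P : ℝ, P ≤ 6 * (1 / (len T t : ℝ)) → half T t * P ≤ 16000000 := by
    intro P hP
    have h1 : half T t * P ≤ half T t * (6 * (1 / (len T t : ℝ))) := by gcongr
    have h2 : half T t * (6 * (1 / (len T t : ℝ))) ≤ 3 := by
      rw [mul_one_div, mul_div_assoc', div_le_iff₀ (by linarith)]
      linarith
    linarith
  by_cases hfar : FarApart p t
  · refine hsmall _ ((prob_roundFails_of_farApart hH hfar).trans ?_)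
    gcongr
    norm_num
  rcases le_or_gt (Real.sqrt (Real.log (len T t) / half T t)) (1 / 40) with hv | hv
  · exact hsmall _ (prob_roundFails_of_not_farApart hH hfar hv)
  have hl := log_len_pos hH
  have h1 : (1 / 40 : ℝ) ^ 2 < Real.log (len T t) / half T t := Real.lt_sqrt (by norm_num) |>.1 hv
  rw [lt_div_iff₀ hH0] at h1
  have h2 := log_len_pow_le hH 2
  norm_num [Nat.factorial] at h2
  have h3 : (half T t : ℝ) ≤ 16000000 := by
    -- `H² ≤ 1600² (log L)² ≤ 1600² * 6 H`.
    have h4 : ((half T t : ℝ)) * half T t ≤ 16000000 * half T t := by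
      have : (half T t : ℝ) ≤ 1600 * Real.log (len T t) := by linarith
      nlinarith
    exact le_of_mul_le_mul_right h4 hH0
  calc _ ≤ (half T t : ℝ) * 1 := by gcongr; exact measureReal_le_one
    _ ≤ _ := by linarith

/-- `α` is displaced only if `m`, the distance of `μ₁` from the nearer end, is below `10v` with `v =
√(log L / H)`; the squared displacement is then at most `2 m v² ≤ 20 v³`. -/
lemma sq_muFirst_sub_alpha_le {p : Fin T → unitInterval} {t : ℕ} (hfar : ¬ FarApart p t) :
    (muFirst p t - alpha p t) ^ 2 ≤ 20 * Real.sqrt (Real.log (len T t) / half T t) ^ 3 := by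
  have hμ := muFirst_mem p t
  have hα := alpha.eq_1 p t
  rw [if_neg hfar] at hα
  have hu : 0 ≤ Real.log (len T t) / half T t :=
    div_nonneg (Real.log_natCast_nonneg _) (Nat.cast_nonneg _)
  have hv2 := Real.sq_sqrt hu
  set v := Real.sqrt (Real.log (len T t) / half T t)
  have hv0 : 0 ≤ v := Real.sqrt_nonneg _
  have hv3 : 0 ≤ v ^ 3 := by positivity
  have key : ∀ m : ℝ, 0 ≤ m → m ≤ 10 * v →
      Real.sqrt (2 * m * Real.log (len T t) / half T t) ^ 2 ≤ 20 * v ^ 3 := by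
    intro m hm0 hm
    have e : 2 * m * Real.log (len T t) / half T t = 2 * m * v ^ 2 := by rw [hv2]; ring
    rw [e, Real.sq_sqrt (by positivity)]
    have := mul_le_mul_of_nonneg_right hm (sq_nonneg v)
    nlinarith
  split_ifs at hα with c1 c2 c3
  · rw [hα, sub_self, zero_pow two_ne_zero]; linarith
  · refine le_trans ?_ (key (muFirst p t) hμ.1 (not_le.1 c2).le)
    have h0 := Real.sqrt_nonneg (2 * muFirst p t * Real.log (len T t) / half T t)
    rw [hα]
    apply sq_le_sq'
    · have := max_le (a := muFirst p t - Real.sqrt (2 * muFirst p t * Real.log (len T t) /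
        half T t)) (b := 0) (c := muFirst p t) (by linarith) hμ.1
      linarith
    · have := le_max_left (muFirst p t - Real.sqrt (2 * muFirst p t * Real.log (len T t) /
        half T t)) 0
      linarith
  · rw [hα, sub_self, zero_pow two_ne_zero]; linarith
  · refine le_trans ?_ (key (1 - muFirst p t) (by linarith [hμ.2]) (not_le.1 c3).le)
    have h0 := Real.sqrt_nonneg (2 * (1 - muFirst p t) * Real.log (len T t) / half T t)
    rw [hα]
    apply sq_le_sq'
    · have := min_le_left (muFirst p t + Real.sqrt (2 * (1 - muFirst p t) * Real.log (len T t) /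
        half T t)) 1
      linarith
    · have := le_min (a := muFirst p t + Real.sqrt (2 * (1 - muFirst p t) * Real.log (len T t) /
        half T t)) (b := 1) (c := muFirst p t) (by linarith) hμ.2
      linarith

/-- `(H v³)² = (log L)³ / H` is bounded. So the displacement of `α` is `O(1/√H)` without a
logarithm, and the first-half bias keeps size `√H`. This is why `α` is displaced only near 0 and 1.
-/
lemma half_mul_sq_muFirst_sub_alpha_le {p : Fin T → unitInterval} {t : ℕ} (hH : 0 < half T t)
    (hfar : ¬ FarApart p t) : half T t * (muFirst p t - alpha p t) ^ 2 ≤ 100 := by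
  have hH0 : (0 : ℝ) < half T t := by exact_mod_cast hH
  have hu : 0 ≤ Real.log (len T t) / half T t :=
    div_nonneg (Real.log_natCast_nonneg _) (Nat.cast_nonneg _)
  have h1 := sq_muFirst_sub_alpha_le hfar
  have hv2 := Real.sq_sqrt hu
  have hv0 := Real.sqrt_nonneg (Real.log (len T t) / half T t)
  set v := Real.sqrt (Real.log (len T t) / half T t)
  have h3 := log_len_pow_le hH 3
  norm_num [Nat.factorial] at h3
  have h4 : (half T t * v ^ 3) ^ 2 ≤ 5 ^ 2 := by
    have : (half T t * v ^ 3) ^ 2 = Real.log (len T t) ^ 3 / half T t := by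
      calc (half T t * v ^ 3) ^ 2 = half T t ^ 2 * (v ^ 2) ^ 3 := by ring
        _ = _ := by rw [hv2]; field_simp
    rw [this, div_le_iff₀ hH0]
    linarith
  have h5 : half T t * v ^ 3 ≤ 5 := (abs_le_of_sq_le_sq' h4 (by norm_num)).2
  have h6 := mul_le_mul_of_nonneg_left h1 hH0.le
  linarith

lemma integral_sq_firstHalfBias_le {p : Fin T → unitInterval} {t : ℕ} (hH : 0 < half T t)
    (hfar : ¬ FarApart p t) :
    ∫ x, firstHalfBias p t x ^ 2 ∂productBernoulli p ≤ 216 * half T t := by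
  have hT := two_mul_half_add_le hH
  have hm := integral_deviation_pow_le p (a := t) (n := half T t) (by omega) 1
  norm_num [Nat.factorial] at hm
  have hα := half_mul_sq_muFirst_sub_alpha_le hH hfar
  have hH0 : (0 : ℝ) < half T t := by exact_mod_cast hH
  calc ∫ x, firstHalfBias p t x ^ 2 ∂productBernoulli p
      ≤ ∫ x, (2 * deviation p t (half T t) x ^ 2 +
          2 * (half T t * (half T t * (muFirst p t - alpha p t) ^ 2))) ∂productBernoulli p := by
        refine integral_mono .of_finite .of_finite fun x => ?_
        dsimp only
        rw [firstHalfBias_eq p hH]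
        nlinarith [sq_nonneg (deviation p t (half T t) x -
          half T t * (muFirst p t - alpha p t))]
    _ = 2 * ∫ x, deviation p t (half T t) x ^ 2 ∂productBernoulli p +
          2 * (half T t * (half T t * (muFirst p t - alpha p t) ^ 2)) := by
        rw [integral_add .of_finite .of_finite, integral_const_mul]
        simp
    _ ≤ _ := by
        have := mul_le_mul_of_nonneg_left hα hH0.le
        linarith

lemma quarter_le_log_len {t : ℕ} (hH : 0 < half T t) : 1 / 4 ≤ Real.log (len T t) := by
  have h2 : 2 ≤ len T t := by unfold half at hH; omega
  have h3 : (2 : ℝ) ≤ len T t := by exact_mod_cast h2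
  have := Real.log_le_log two_pos h3
  linarith [Real.log_two_gt_d9]

lemma abs_alpha_sub_beta_le {p : Fin T → unitInterval} {t : ℕ} (hH : 0 < half T t)
    (hfar : ¬ FarApart p t) (Δ : ℝ) :
    |alpha p t - beta p t Δ| ≤
      24 * Real.sqrt (Real.log (len T t) / half T t) + |Δ| / half T t := by
  have hH0 : (0 : ℝ) < half T t := by exact_mod_cast hH
  have hl := quarter_le_log_len hH
  have hu : 0 ≤ Real.log (len T t) / half T t := by positivity
  have hv2 := Real.sq_sqrt hu
  have hv0 := Real.sqrt_nonneg (Real.log (len T t) / half T t)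
  have hα := half_mul_sq_muFirst_sub_alpha_le hH hfar
  have hμ := abs_muFirst_sub_muSecond_le hH hfar
  have hs := sqrt_log_div_two_mul_le hH
  have hs0 := Real.sqrt_nonneg (Real.log (len T t) / (2 * half T t))
  have h2 := muSecond_mem p t
  have hβ := beta.eq_1 p t Δ
  set v := Real.sqrt (Real.log (len T t) / half T t)
  -- From `100 ≤ 400 log L`. The total `24` is `20 + 3 + 1`, along `α`, `μ₁`, `μ₂`, `β`.
  have h1 : |alpha p t - muFirst p t| ≤ 20 * v := by
    rw [abs_sub_comm]
    refine abs_le_of_sq_le_sq ?_ (by positivity)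
    have h3 : (half T t : ℝ) * (muFirst p t - alpha p t) ^ 2 ≤ half T t * (20 * v) ^ 2 := by
      refine hα.trans ?_
      rw [mul_pow, hv2]
      have : half T t * (20 ^ 2 * (Real.log (len T t) / half T t)) =
        400 * Real.log (len T t) := by field_simp; norm_num
      rw [this]; linarith
    exact le_of_mul_le_mul_left h3 hH0
  have h4 : |muSecond p t - beta p t Δ| ≤ |Δ| / half T t + v := by
    split_ifs at hβ with h0
    · have hd : 0 ≤ Δ / half T t := by positivity
      rw [abs_of_nonneg h0, hβ, abs_le]
      refine ⟨?_, ?_⟩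
      · linarith [min_le_left (muSecond p t + Δ / half T t +
          Real.sqrt (Real.log (len T t) / (2 * half T t))) 1]
      · have := le_min (a := muSecond p t + Δ / half T t +
          Real.sqrt (Real.log (len T t) / (2 * half T t))) (b := 1) (c := muSecond p t)
          (by linarith) h2.2
        linarith
    · have hd : 0 ≤ -Δ / half T t := div_nonneg (by linarith) hH0.le
      have hd' : Δ / half T t = -(-Δ / half T t) := by ring
      rw [abs_of_neg (not_le.1 h0), hβ, abs_le, hd']
      refine ⟨?_, ?_⟩
      · have := max_le (a := muSecond p t + -(-Δ / half T t) -
          Real.sqrt (Real.log (len T t) / (2 * half T t))) (b := 0) (c := muSecond p t)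
          (by linarith) h2.1
        linarith
      · linarith [le_max_left (muSecond p t + -(-Δ / half T t) -
          Real.sqrt (Real.log (len T t) / (2 * half T t))) 0]
  calc |alpha p t - beta p t Δ| = |(alpha p t - muFirst p t) + (muFirst p t - muSecond p t) +
        (muSecond p t - beta p t Δ)| := by congr 1; ring
    _ ≤ _ := (abs_add_three _ _ _).trans (by linarith)

lemma integral_abs_firstHalfBias_mul_le {p : Fin T → unitInterval} {t : ℕ} (hH : 0 < half T t)
    (hfar : ¬ FarApart p t) :
    ∫ x, |firstHalfBias p t x| * |alpha p t - beta p t (firstHalfBias p t x)|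
      ∂productBernoulli p ≤ 3036 * Real.sqrt (Real.log (len T t)) := by
  have hH0 : (0 : ℝ) < half T t := by exact_mod_cast hH
  have hl := quarter_le_log_len hH
  have hsq := integral_sq_firstHalfBias_le hH hfar
  set h := Real.sqrt (half T t) with hh
  have hh0 : 0 < h := Real.sqrt_pos.2 hH0
  have hh2 : h ^ 2 = half T t := Real.sq_sqrt hH0.le
  set r := Real.sqrt (Real.log (len T t)) with hr
  have hr0 : 1 / 2 ≤ r := by
    apply Real.le_sqrt_of_sq_le; linarith
  have hv : Real.sqrt (Real.log (len T t) / half T t) = r / h := Real.sqrt_div' _ hH0.le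
  have hpt : ∀ x, |firstHalfBias p t x| * |alpha p t - beta p t (firstHalfBias p t x)| ≤
      (12 * r + 1) / h ^ 2 * firstHalfBias p t x ^ 2 + 12 * r := by
    intro x
    set Δ := firstHalfBias p t x
    have h1 := abs_alpha_sub_beta_le hH hfar Δ
    rw [hv, ← hh2] at h1
    -- Makes the linear term quadratic, so that the second moment of the bias suffices.
    have h2 : 2 * (|Δ| / h) ≤ (|Δ| / h) ^ 2 + 1 := by nlinarith [sq_nonneg (|Δ| / h - 1)]
    calc |Δ| * |alpha p t - beta p t Δ| ≤ |Δ| * (24 * (r / h) + |Δ| / h ^ 2) := by gcongr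
      _ = 12 * r * (2 * (|Δ| / h)) + (|Δ| / h) ^ 2 := by field_simp; ring
      _ ≤ 12 * r * ((|Δ| / h) ^ 2 + 1) + (|Δ| / h) ^ 2 := by gcongr
      _ = (12 * r + 1) / h ^ 2 * |Δ| ^ 2 + 12 * r := by field_simp; ring
      _ = _ := by rw [sq_abs]
  calc _ ≤ ∫ x, ((12 * r + 1) / h ^ 2 * firstHalfBias p t x ^ 2 + 12 * r) ∂productBernoulli p :=
        integral_mono .of_finite .of_finite hpt
    _ = (12 * r + 1) / h ^ 2 * ∫ x, firstHalfBias p t x ^ 2 ∂productBernoulli p + 12 * r := by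
        rw [integral_add .of_finite .of_finite, integral_const_mul]
        simp
    _ ≤ (12 * r + 1) / h ^ 2 * (216 * h ^ 2) + 12 * r := by
        rw [hh2]
        gcongr
    _ = 216 * (12 * r + 1) + 12 * r := by field_simp
    _ ≤ _ := by linarith

/-- The expected cost of a round is `O(√(log T))`. -/
lemma integral_roundCost_le (hT : 2 ≤ T) (p : Fin T → unitInterval) (t : ℕ) :
    ∫ x, roundCost p t x ∂productBernoulli p ≤ 10 ^ 9 * Real.sqrt (Real.log T) := by
  classical
  have hT' : (2 : ℝ) ≤ T := by exact_mod_cast hT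
  have hlT : 1 / 4 ≤ Real.log T := by
    linarith [Real.log_le_log two_pos hT', Real.log_two_gt_d9]
  have hr0 : 1 / 2 ≤ Real.sqrt (Real.log T) := by
    apply Real.le_sqrt_of_sq_le; linarith
  rcases Nat.eq_zero_or_pos (half T t) with hH | hH
  · have : ∀ x, roundCost p t x = 11 := fun x => by
      simp [roundCost, firstHalfBias, hH]
    simp only [this, integral_const, probReal_univ, smul_eq_mul]
    linarith
  have hlen : (len T t : ℝ) ≤ T := by
    have : len T t ≤ T := Nat.sub_le _ _
    exact_mod_cast this
  have hlen0 : (0 : ℝ) < len T t := by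
    have : 0 < len T t := by unfold half at hH; omega
    exact_mod_cast this
  have hmono : Real.sqrt (Real.log (len T t)) ≤ Real.sqrt (Real.log T) :=
    Real.sqrt_le_sqrt (Real.log_le_log hlen0 hlen)
  have hfail : ∫ x, (if RoundFails p t x then 18 * (half T t : ℝ) else 0) ∂productBernoulli p ≤
      18 * 16000000 := by
    have h1 : ∀ x, (if RoundFails p t x then 18 * (half T t : ℝ) else 0) =
        Set.indicator {x | RoundFails p t x} (fun _ => 18 * (half T t : ℝ)) x := fun x => by
      simp [Set.indicator]
    simp only [h1]
    rw [integral_indicator_const _ (Set.toFinite _).measurableSet, smul_eq_mul]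
    have := half_mul_prob_roundFails_le p hH
    linarith
  have hswap : ∫ x, (if FarApart p t then 0 else 8 * (|firstHalfBias p t x| *
      |alpha p t - beta p t (firstHalfBias p t x)|)) ∂productBernoulli p ≤
      8 * (3036 * Real.sqrt (Real.log T)) := by
    by_cases hfar : FarApart p t
    · simp only [if_pos hfar, integral_zero]; positivity
    · simp only [if_neg hfar]
      rw [integral_const_mul]
      have := integral_abs_firstHalfBias_mul_le hH hfar
      linarith
  unfold roundCost
  rw [integral_add .of_finite .of_finite, integral_add .of_finite .of_finite]
  simp only [integral_const, probReal_univ, smul_eq_mul, one_mul]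
  linarith

/-! ### Independence of the past and the future -/

lemma integral_mul_of_dependsOn (p : Fin T → unitInterval) {f g : (Fin T → Bool) → ℝ}
    (S : Finset (Fin T)) (hf : ∀ x y : Fin T → Bool, (∀ i ∈ S, x i = y i) → f x = f y)
    (hg : ∀ x y : Fin T → Bool, (∀ i ∉ S, x i = y i) → g x = g y) :
    ∫ x, f x * g x ∂productBernoulli p =
      (∫ x, f x ∂productBernoulli p) * ∫ x, g x ∂productBernoulli p := by
  classical
  have hind : ProbabilityTheory.iIndepFun (fun s (x : Fin T → Bool) => x s)
      (productBernoulli p) :=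
    ProbabilityTheory.iIndepFun_pi (X := fun _ b => b) (fun _ => aemeasurable_id)
  have h := hind.indepFun_finset S Sᶜ disjoint_compl_right fun _ => Measurable.of_discrete
  have h2 := h.comp (φ := fun y : S → Bool => f fun i => if hi : i ∈ S then y ⟨i, hi⟩ else false)
    (ψ := fun y : (Sᶜ : Finset (Fin T)) → Bool =>
      g fun i => if hi : i ∈ Sᶜ then y ⟨i, hi⟩ else false) .of_discrete .of_discrete
  have e1 : ((fun y : S → Bool => f fun i => if hi : i ∈ S then y ⟨i, hi⟩ else false) ∘
      fun (x : Fin T → Bool) (i : S) => x i) = f := by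
    funext x
    exact hf _ _ fun i hi => by simp [hi]
  have e2 : ((fun y : (Sᶜ : Finset (Fin T)) → Bool =>
      g fun i => if hi : i ∈ Sᶜ then y ⟨i, hi⟩ else false) ∘
      fun (x : Fin T → Bool) (i : (Sᶜ : Finset (Fin T))) => x i) = g := by
    funext x
    exact hg _ _ fun i hi => by simp [hi]
  rw [e1, e2] at h2
  exact h2.integral_fun_mul_eq_mul_integral Measurable.of_discrete.aestronglyMeasurable
    Measurable.of_discrete.aestronglyMeasurable

/-- The cost is defined along a fictitious continuation of the round, whether or not a round starts
after `t` steps or gets that far; hence it ignores the outcomes before `t`. -/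
lemma roundCost_congr (p : Fin T → unitInterval) {t : ℕ} {x y : Fin T → Bool}
    (h : ∀ s, t ≤ s → outcome x s = outcome y s) : roundCost p t x = roundCost p t y := by
  have h1 : firstHalfBias p t x = firstHalfBias p t y :=
    Finset.sum_congr rfl fun j _ => by rw [h _ (Nat.le_add_right t j)]
  have h2 : roundPrediction p t x = roundPrediction p t y := by
    funext j; rw [roundPrediction, roundPrediction, h1]
  have h3 : roundBias p t x = roundBias p t y := by
    funext i
    exact Finset.sum_congr rfl fun j _ => by rw [h _ (Nat.le_add_right t j), h2]
  have h4 : RoundFails p t x ↔ RoundFails p t y := by rw [RoundFails, RoundFails, h3]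
  unfold roundCost
  rw [h1, propext h4]

lemma stateAt_congr (p : Fin T → unitInterval) {x y : Fin T → Bool} (t : ℕ)
    (h : ∀ s < t, outcome x s = outcome y s) : stateAt p x t = stateAt p y t := by
  induction t with
  | zero => rfl
  | succ t ih => rw [stateAt, stateAt, ih fun s hs => h s (by omega), h t (by omega)]

open Classical in
lemma integral_roundStarts_mul (p : Fin T → unitInterval) (t : ℕ) :
    ∫ x, (if RoundStarts p x t then 1 else 0) * roundCost p t x ∂productBernoulli p =
      (∫ x, (if RoundStarts p x t then 1 else 0) ∂productBernoulli p) *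
        ∫ x, roundCost p t x ∂productBernoulli p := by
  refine integral_mul_of_dependsOn p (Finset.univ.filter fun i : Fin T => (i : ℕ) < t) ?_ ?_
  · intro x y h
    have : stateAt p x t = stateAt p y t := stateAt_congr p t fun s hs => by
      unfold outcome
      split_ifs with hsT
      · exact h _ (by simpa using hs)
      · rfl
    rw [RoundStarts, RoundStarts, this]
  · intro x y h
    refine roundCost_congr p fun s hs => ?_
    unfold outcome
    split_ifs with hsT
    · exact h _ (by simpa using hs)
    · rfl

lemma err_calDist_productForecaster_le (hT : 2 ≤ T) (p : Fin T → unitInterval) :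
    err calDist (productBernoulli p) (productForecaster p) ≤
      4 * 10 ^ 9 * Real.log T ^ (3 / 2 : ℝ) := by
  classical
  have hT' : (2 : ℝ) ≤ T := by exact_mod_cast hT
  have hlT : 1 / 2 ≤ Real.log T := by
    linarith [Real.log_le_log two_pos hT', Real.log_two_gt_d9]
  have hlog : ((Nat.log 2 T + 1 : ℕ) : ℝ) ≤ 4 * Real.log T := by
    have h1 := Real.natLog_le_logb T 2
    rw [Real.logb, Nat.cast_ofNat, le_div_iff₀ (Real.log_pos one_lt_two)] at h1
    push_cast
    nlinarith [Real.log_two_gt_d9, (Nat.cast_nonneg (Nat.log 2 T) : (0 : ℝ) ≤ Nat.log 2 T)]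
  have hK : 0 ≤ 10 ^ 9 * Real.sqrt (Real.log T) := by positivity
  calc err calDist (productBernoulli p) (productForecaster p)
      ≤ ∫ x, ∑ s ∈ Finset.range T, (if RoundStarts p x s then 1 else 0) * roundCost p s x
          ∂productBernoulli p := by
        refine integral_mono .of_finite .of_finite fun x => (calDist_run_le p x).trans ?_
        simp
    _ = ∑ s ∈ Finset.range T, (∫ x, (if RoundStarts p x s then 1 else 0) ∂productBernoulli p) *
          ∫ x, roundCost p s x ∂productBernoulli p := by
        rw [integral_finsetSum _ fun _ _ => .of_finite]
        exact Finset.sum_congr rfl fun s _ => integral_roundStarts_mul p s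
    _ ≤ ∑ s ∈ Finset.range T, (∫ x, (if RoundStarts p x s then 1 else 0) ∂productBernoulli p) *
          (10 ^ 9 * Real.sqrt (Real.log T)) := by
        refine Finset.sum_le_sum fun s _ => mul_le_mul_of_nonneg_left
          (integral_roundCost_le hT p s) (integral_nonneg fun x => ?_)
        dsimp only
        split_ifs <;> simp
    _ = (∫ x, ∑ s ∈ Finset.range T, (if RoundStarts p x s then 1 else 0) ∂productBernoulli p) *
          (10 ^ 9 * Real.sqrt (Real.log T)) := by
        rw [integral_finsetSum _ fun _ _ => .of_finite, Finset.sum_mul]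
    _ ≤ (∫ _x, ((Nat.log 2 T + 1 : ℕ) : ℝ) ∂productBernoulli p) *
          (10 ^ 9 * Real.sqrt (Real.log T)) := by
        refine mul_le_mul_of_nonneg_right (integral_mono .of_finite .of_finite fun x => ?_) hK
        have := sum_roundStarts_le p x (by omega)
        exact_mod_cast this
    _ ≤ 4 * Real.log T * (10 ^ 9 * Real.sqrt (Real.log T)) := by
        rw [integral_const, probReal_univ, one_smul]
        gcongr
    _ = _ := by
        have : Real.log T ^ (3 / 2 : ℝ) = Real.log T * Real.sqrt (Real.log T) := by
          rw [Real.sqrt_eq_rpow, show (3 / 2 : ℝ) = 1 + 1 / 2 by norm_num,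
            Real.rpow_add (by linarith), Real.rpow_one]
        rw [this]; ring

lemma err_smCE_le (D : Measure (Fin T → Bool)) [IsProbabilityMeasure D] (A : Forecaster T) :
    err smCE D A ≤ 2 * err calDist D A := by
  rw [err, err, ← integral_const_mul]
  exact integral_mono .of_finite .of_finite fun x => smCE_le_two_mul_calDist x _

/-! ### The truthful forecaster -/

lemma integral_bit (p : Fin T → unitInterval) (t : Fin T) :
    ∫ x, bit (x t) ∂productBernoulli p = p t := by
  have := integral_noise p t fun y => y + p t
  simp only [sub_add_cancel] at this
  rw [this]; ring

lemma measureReal_singleton_pos {p : Fin T → unitInterval}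
    (hp : ∀ t, 0 < (p t : ℝ) ∧ (p t : ℝ) < 1) (x : Fin T → Bool) :
    0 < (productBernoulli p).real {x} := by
  rw [Measure.real, ENNReal.toReal_pos_iff]
  refine ⟨?_, measure_lt_top _ _⟩
  rw [productBernoulli, Measure.pi_singleton, pos_iff_ne_zero, Finset.prod_ne_zero_iff]
  intro t _ h0
  have h1 : (ProbabilityTheory.bernoulliMeasure true false (p t)).real {x t} = 0 := by
    rw [Measure.real, h0, ENNReal.toReal_zero]
  rw [ProbabilityTheory.bernoulliMeasure_real_apply _ (measurableSet_singleton _)] at h1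
  have := hp t
  cases hx : x t <;> simp [hx] at h1
  · linarith
  · have h2 := congrArg Subtype.val h1
    simp only [Set.Icc.coe_zero] at h2
    linarith

/-- On a product distribution of full support the truthful forecaster predicts the parameters. -/
lemma run_truthful {p : Fin T → unitInterval} (hp : ∀ t, 0 < (p t : ℝ) ∧ (p t : ℝ) < 1)
    (x : Fin T → Bool) : run (truthful (productBernoulli p)) x = p := by
  classical
  funext t
  apply Subtype.ext
  set A := {y : Fin T → Bool | history y t = history x t} with hA
  -- The history has positive probability, so after factoring by independence it cancels in the
  -- conditional probability.
  have hApos : 0 < (productBernoulli p).real A :=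
    (measureReal_singleton_pos hp x).trans_le (measureReal_mono (by simp [hA]))
  change (ProbabilityTheory.cond (productBernoulli p) A).real {y | y t = true} = p t
  rw [Measure.real, ProbabilityTheory.cond_apply (Set.toFinite A).measurableSet,
    ENNReal.toReal_mul, ENNReal.toReal_inv, ← Measure.real, ← Measure.real]
  have h1 := integral_mul_of_dependsOn p (f := A.indicator fun _ => 1) (g := fun y => bit (y t))
    (Finset.univ.filter fun i : Fin T => (i : ℕ) < t) (by
      intro y z h
      have : history y t = history z t := by
        funext s
        exact h _ (Finset.mem_filter.2 ⟨Finset.mem_univ _, s.isLt⟩)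
      simp only [Set.indicator, hA, Set.mem_ofPred_eq, this])
    (by
      intro y z h
      rw [h t (by simp)])
  have h2 : (fun y => A.indicator (fun _ => (1 : ℝ)) y * bit (y t)) =
      (A ∩ {y | y t = true}).indicator fun _ => 1 := by
    funext y
    by_cases h3 : y ∈ A <;> cases h4 : y t <;> simp [Set.indicator, h3, h4, bit]
  rw [h2, integral_bit, integral_indicator_const _ (Set.toFinite _).measurableSet,
    integral_indicator_const _ (Set.toFinite _).measurableSet] at h1
  simp only [smul_eq_mul, mul_one] at h1
  rw [h1]
  field_simp

/-! ### The total noise has first absolute moment of order `√T` -/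

lemma deviation_eq_sum (p : Fin T → unitInterval) (x : Fin T → Bool) :
    deviation p 0 T x = ∑ t, (bit (x t) - p t) := by
  rw [deviation_eq_sum_fin p (zero_add T).le]
  simp

lemma abs_deviation_le_smCE (p : Fin T → unitInterval) (x : Fin T → Bool) :
    |deviation p 0 T x| ≤ smCE x p := by
  rw [deviation_eq_sum]
  refine abs_le'.2 ⟨le_csSup (bddAbove_smCE x p) ⟨fun _ => 1, LipschitzWith.const' 1, by simp, ?_⟩,
    le_csSup (bddAbove_smCE x p) ⟨fun _ => -1, LipschitzWith.const' _, by simp, ?_⟩⟩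
  · simp
  · simp

lemma le_integral_deviation_sq {δ : ℝ} (hδ0 : 0 < δ) (hδ : δ ≤ 1 / 2) {p : Fin T → unitInterval}
    (hp : ∀ t, δ ≤ (p t : ℝ) ∧ (p t : ℝ) ≤ 1 - δ) :
    δ / 2 * T ≤ ∫ x, deviation p 0 T x ^ 2 ∂productBernoulli p := by
  have h1 := ProbabilityTheory.variance_sum_pi
    (μ := fun t => ProbabilityTheory.bernoulliMeasure true false (p t))
    (X := fun t b => bit b - (p t : ℝ)) (fun t => MemLp.of_discrete)
  have h2 : ∀ t, δ / 2 ≤ ProbabilityTheory.variance (fun b => bit b - (p t : ℝ))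
      (ProbabilityTheory.bernoulliMeasure true false (p t)) := fun t => by
    rw [ProbabilityTheory.variance_eq_sub MemLp.of_discrete]
    simp only [Pi.pow_apply, ProbabilityTheory.integral_bernoulliMeasure, bit, smul_eq_mul]
    have := hp t
    norm_num
    -- The variance is `p(1 - p) ≥ δ(1 - δ) ≥ δ/2`.
    nlinarith [mul_nonneg (sub_nonneg.2 this.1) (sub_nonneg.2 this.2)]
  have h3 : (∑ t, fun x : Fin T → Bool => bit (x t) - (p t : ℝ)) = deviation p 0 T := by
    funext x
    rw [deviation_eq_sum, Finset.sum_apply]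
  rw [h3] at h1
  have h4 : ProbabilityTheory.variance (deviation p 0 T) (productBernoulli p) ≤
      ∫ x, deviation p 0 T x ^ 2 ∂productBernoulli p :=
    ProbabilityTheory.variance_le_expectation_sq Measurable.of_discrete.aestronglyMeasurable
  refine le_trans ?_ h4
  rw [productBernoulli, h1]
  calc δ / 2 * T = ∑ _t : Fin T, δ / 2 := by simp; ring
    _ ≤ _ := Finset.sum_le_sum fun t _ => h2 t

/-- Integrate `|y| ≥ l y² - l³ y⁴`, which follows from `1 - z + z³ ≥ 0` for `z ≥ 0`, and insert the
second and fourth moments. -/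
lemma le_integral_abs_deviation {δ : ℝ} (hδ0 : 0 < δ) (hδ : δ ≤ 1 / 2)
    {p : Fin T → unitInterval} (hp : ∀ t, δ ≤ (p t : ℝ) ∧ (p t : ℝ) ≤ 1 - δ) :
    δ ^ 2 / 80 * Real.sqrt T ≤ ∫ x, |deviation p 0 T x| ∂productBernoulli p := by
  rcases Nat.eq_zero_or_pos T with rfl | hT
  · simp [deviation]
  have hT0 : (0 : ℝ) < T := by exact_mod_cast hT
  have h2 := le_integral_deviation_sq hδ0 hδ hp
  have h4 := integral_deviation_pow_le p (zero_add T).le 2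
  norm_num [Nat.factorial] at h4
  set r := Real.sqrt T with hr
  have hr0 : 0 < r := Real.sqrt_pos.2 hT0
  have hr2 : (T : ℝ) = r ^ 2 := (Real.sq_sqrt hT0.le).symm
  rw [hr2] at h2 h4
  -- Small enough that the fourth-moment loss `96 (δ/20)³ r` stays below the gain `(δ/20)(δ/2) r`.
  set l := δ / 20 / r with hl
  have hl0 : 0 < l := by positivity
  have hlr : l * r = δ / 20 := by rw [hl]; field_simp
  have hpt : ∀ y : ℝ, l * y ^ 2 - l ^ 3 * y ^ 4 ≤ |y| := by
    intro y
    have h5 : 0 ≤ 1 - l * |y| + (l * |y|) ^ 3 := by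
      have : 0 ≤ l * |y| := by positivity
      nlinarith [sq_nonneg (l * |y| - 1), mul_nonneg this (sq_nonneg (l * |y| - 1))]
    have h6 := mul_nonneg (abs_nonneg y) h5
    have h7 : |y| ^ 4 = y ^ 4 := by rw [show 4 = 2 * 2 by norm_num, pow_mul, sq_abs, pow_mul]
    have h8 : |y| * (1 - l * |y| + (l * |y|) ^ 3) = |y| - l * |y| ^ 2 + l ^ 3 * |y| ^ 4 := by ring
    rw [h8, sq_abs, h7] at h6
    linarith
  calc δ ^ 2 / 80 * r ≤ l * (δ / 2 * r ^ 2) - l ^ 3 * (96 * (r ^ 2) ^ 2) := by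
        have e : l * (δ / 2 * r ^ 2) - l ^ 3 * (96 * (r ^ 2) ^ 2) =
            ((l * r) * (δ / 2) - 96 * (l * r) ^ 3) * r := by ring
        rw [e, hlr]
        apply mul_le_mul_of_nonneg_right _ hr0.le
        nlinarith [mul_le_mul_of_nonneg_left hδ (sq_nonneg δ)]
    _ ≤ l * ∫ x, deviation p 0 T x ^ 2 ∂productBernoulli p -
          l ^ 3 * ∫ x, deviation p 0 T x ^ 4 ∂productBernoulli p := by gcongr
    _ = ∫ x, (l * deviation p 0 T x ^ 2 - l ^ 3 * deviation p 0 T x ^ 4)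
          ∂productBernoulli p := by
        rw [integral_sub .of_finite .of_finite, integral_const_mul, integral_const_mul]
    _ ≤ _ := integral_mono .of_finite .of_finite fun x => hpt _

lemma le_err_smCE_truthful {δ : ℝ} (hδ0 : 0 < δ) (hδ : δ ≤ 1 / 2)
    {p : Fin T → unitInterval} (hp : ∀ t, δ ≤ (p t : ℝ) ∧ (p t : ℝ) ≤ 1 - δ) :
    δ ^ 2 / 80 * Real.sqrt T ≤
      err smCE (productBernoulli p) (truthful (productBernoulli p)) := by
  refine (le_integral_abs_deviation hδ0 hδ hp).trans ?_
  refine integral_mono .of_finite .of_finite fun x => ?_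
  dsimp only
  rw [run_truthful (fun t => ⟨by linarith [(hp t).1], by linarith [(hp t).2]⟩)]
  exact abs_deviation_le_smCE p x

end SeqPred

end

theorem theoremB1 :
    (∃ C : ℝ, 0 < C ∧ ∀ T : ℕ, 2 ≤ T → ∀ p : Fin T → unitInterval,
      SeqPred.err SeqPred.smCE (SeqPred.productBernoulli p) (SeqPred.productForecaster p)
          ≤ C * Real.log T ^ (3 / 2 : ℝ) ∧
      SeqPred.err SeqPred.calDist (SeqPred.productBernoulli p) (SeqPred.productForecaster p)
          ≤ C * Real.log T ^ (3 / 2 : ℝ)) ∧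
    (∀ δ : ℝ, 0 < δ → δ ≤ 1 / 2 →
      ∃ c : ℝ, 0 < c ∧ ∀ T : ℕ, ∀ p : Fin T → unitInterval,
        (∀ t, δ ≤ (p t : ℝ) ∧ (p t : ℝ) ≤ 1 - δ) →
        c * Real.sqrt T ≤ SeqPred.err SeqPred.smCE (SeqPred.productBernoulli p)
          (SeqPred.truthful (SeqPred.productBernoulli p)) ∧
        c * Real.sqrt T ≤ SeqPred.err SeqPred.calDist (SeqPred.productBernoulli p)
          (SeqPred.truthful (SeqPred.productBernoulli p))) := by
  -- The factor 2 between `smCE` and `calDist` doubles `4 * 10 ^ 9` and halves `δ ^ 2 / 80`.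
  refine ⟨⟨8 * 10 ^ 9, by norm_num, fun T hT p => ?_⟩, fun δ hδ0 hδ =>
    ⟨δ ^ 2 / 160, by positivity, fun T p hp => ?_⟩⟩
  · have h1 := SeqPred.err_calDist_productForecaster_le hT p
    have h2 := SeqPred.err_smCE_le (SeqPred.productBernoulli p) (SeqPred.productForecaster p)
    have h3 : 0 ≤ Real.log T ^ (3 / 2 : ℝ) := Real.rpow_nonneg (Real.log_natCast_nonneg T) _
    constructor <;> linarith
  · have h1 := SeqPred.le_err_smCE_truthful hδ0 hδ hp
    have h2 := SeqPred.err_smCE_le (SeqPred.productBernoulli p)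
      (SeqPred.truthful (SeqPred.productBernoulli p))
    have h3 : 0 ≤ δ ^ 2 * Real.sqrt T := by positivity
    constructor <;> linarith
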